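/- **Setting.** Let $\Xi\subseteq\mathbb R^m$ and $\Theta\subseteq\mathbb R^d$ be sets, $K<\infty$, and let $h:\Theta\times\Xi\to[0,K]$ be measurable in its second argument. Let $\phi:[0,K]\to[0,\infty)$ be continuous, convex and strictly increasing. Fix a sample $\boldsymbol\xi^n=(\xi_1,\dots,\xi_n)\in\Xi^n$ with empirical distribution $p_{\boldsymbol\xi^n}=\frac1n\sum_{i=1}^n\delta_{\xi_i}$, a concentration $\alpha>0$ and a probability measure $p_0$ on $\Xi$. Let $q=\frac{\alpha}{\alpha+n}p_0+\frac{n}{\alpha+n}p_{\boldsymbol\xi^n}$ be the predictive distribution, and let $Q$ be the Dirichlet process posterior $\mathrm{DP}(\alpha+n,q)$, that is, the law on probability measures $p$ on $\Xi$ such that $(p(A_1),\dots,p(A_k))\sim\mathrm{Dirichlet}\big((\alpha+n)q(A_1),\dots,(\alpha+n)q(A_k)\big)$ for every finite measurable partition $A_1,\dots,A_k$ of $\Xi$. Put $$V(\theta)=\int\phi\Big(\int_\Xi h(\theta,\xi)\,p(d\xi)\Big)\,Q(dp).$$ Let $B_{ij}\sim\mathrm{Beta}(1,\alpha+n)$ $(i,j\ge1)$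 and $\xi_{ij}\sim q$ $(i\ge1,\ j\ge0)$ be mutually independent random variables on one probability space. For $T\ge 1$ set $p_{ij}=B_{ij}\prod_{k=1}^{j-1}(1-B_{ik})$ for $1\le j\le T$ and $p_{i0}=\prod_{k=1}^{T}(1-B_{ik})$, and let $$\hat V(\theta,T,N)=\frac1N\sum_{i=1}^N\phi\Big(\sum_{j=0}^Tp_{ij}\,h(\theta,\xi_{ij})\Big)\qquad(T,N\ge1).$$ **Theorem.** Assume that $\Theta$ is bounded and that, for every $\xi\in\Xi$, $\theta\mapsto h(\theta,\xi)$ is $c(\xi)$-Lipschitz on $\Theta$, where $c:\Xi\to[0,\infty)$ is measurable. Let $C_T=\mathbb E\big[\sum_{j=0}^Tp_{1j}\,c(\xi_{1j})\big]$ and assume $\sup_{T\ge1}C_T<\infty$. Then, almost surely, $$\lim_{T,N\to\infty}\ \sup_{\theta\in\Theta}\big|\hat V(\theta,T,N)-V(\theta)\big|=0 .$$ Moreover, let $\theta_n\in\arg\min_{\theta\in\Theta}V(\theta)$. Then, almost surely, for every choice of $\hat\theta_n(T,N)\in\arg\min_{\theta\in\Theta}\hat V(\theta,T,N)$ $(T,N\ge1)$,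 $$\lim_{T,N\to\infty}\hat V\big(\hat\theta_n(T,N),T,N\big)=V(\theta_n),\qquad \lim_{T,N\to\infty}V\big(\hat\theta_n(T,N)\big)=V(\theta_n).$$ Here $\lim_{T,N\to\infty}$ is the joint limit, along the pairs $(T,N)$ as $\min(T,N)\to\infty$. -/

import Mathlib

open MeasureTheory ProbabilityTheory Set Filter Topology
open scoped ENNReal NNReal

noncomputable section

/-- The Gamma distribution with shape `a` and rate `1`; shape `0` is the point mass at `0`. -/
def gammaShape (a : ℝ) : Measure ℝ :=
  if a = 0 then Measure.dirac 0 else gammaMeasure a 1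

/-- The Dirichlet distribution with nonnegative parameters `a`, not all zero: the law of
`(G i / ∑ l, G l)_i` for independent `G i` with distribution `Gamma (a i, 1)`. -/
def dirichletMeasure {k : ℕ} (a : Fin k → ℝ) : Measure (Fin k → ℝ) :=
  (Measure.pi fun i => gammaShape (a i)).map fun g i => g i / ∑ l, g l

/-- `Q` is the Dirichlet process `DP (η, q)`: for every finite measurable partition
`A 0, …, A (k - 1)`, the vector `(p (A i))_i` with `p` drawn from `Q` has distribution
`Dirichlet (η q(A 0), …, η q(A (k - 1)))`. -/
def IsDirichletProcess {X : Type*} [MeasurableSpace X] (η : ℝ) (q : Measure X)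
    (Q : Measure (ProbabilityMeasure X)) : Prop :=
  ∀ (k : ℕ) (A : Fin k → Set X), (∀ i, MeasurableSet (A i)) →
    Pairwise (fun i j => Disjoint (A i) (A j)) → (⋃ i, A i) = univ →
    HasLaw (fun (p : ProbabilityMeasure X) (i : Fin k) => (p : Measure X).real (A i))
      (dirichletMeasure fun i => η * q.real (A i)) Q

/-- The empirical distribution of a sample of size `n`. -/
def empiricalDist {X : Type*} [MeasurableSpace X] {n : ℕ} (data : Fin n → X) : Measure X :=
  (n : ℝ≥0∞)⁻¹ • ∑ i, Measure.dirac (data i)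

/-- The predictive distribution `α / (α + n) p₀ + n / (α + n) p_data`. -/
def predictiveDist {X : Type*} [MeasurableSpace X] (α : ℝ) (p₀ : Measure X) {n : ℕ}
    (data : Fin n → X) : Measure X :=
  ENNReal.ofReal (α / (α + n)) • p₀ + ENNReal.ofReal (n / (α + n)) • empiricalDist data

/-- The Dirichlet process posterior given the sample `data`, when the prior is `DP (α, p₀)`:
the Dirichlet process with concentration `α + n` centred at the predictive distribution. -/
def IsDPPosterior {X : Type*} [MeasurableSpace X] (α : ℝ) (p₀ : Measure X) {n : ℕ}
    (data : Fin n → X) (Q : Measure (ProbabilityMeasure X)) : Prop :=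
  IsDirichletProcess (α + n) (predictiveDist α p₀ data) Q

/-- The expected risk of the decision `θ` when the data have distribution `p`. -/
def risk {E X : Type*} [MeasurableSpace X] (h : E → X → ℝ) (p : Measure X) (θ : E) : ℝ :=
  ∫ x, h θ x ∂p

/-- The criterion `V(θ)`, the integral of `φ (risk h p θ)` over `p` drawn from `Q`. -/
def criterion {E X : Type*} [MeasurableSpace X] (φ : ℝ → ℝ) (h : E → X → ℝ)
    (Q : Measure (ProbabilityMeasure X)) (θ : E) : ℝ :=
  ∫ p, φ (risk h (p : Measure X) θ) ∂Q

/-- The integral of `f` with respect to the stick-breaking measure truncated at step `T`.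
The break of step `j + 1` is `b j` and its atom is `x (j + 1)`; the stick that is left after
`T` steps goes to the atom `x 0`. -/
def truncatedIntegral {X : Type*} (b : ℕ → ℝ) (x : ℕ → X) (T : ℕ) (f : X → ℝ) : ℝ :=
  (∏ k ∈ Finset.range T, (1 - b k)) * f (x 0) +
    ∑ j ∈ Finset.range T, b j * (∏ k ∈ Finset.range j, (1 - b k)) * f (x (j + 1))

/-- The stick-breaking Monte Carlo criterion with truncation step `T` and `N` samples, for given
breaks `b i j` and atoms `x i j`. -/
def approxCriterion {E X : Type*} (φ : ℝ → ℝ) (h : E → X → ℝ) (b : ℕ → ℕ → ℝ) (x : ℕ → ℕ → X)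
    (θ : E) (T N : ℕ) : ℝ :=
  (N : ℝ)⁻¹ * ∑ i ∈ Finset.range N, φ (truncatedIntegral (b i) (x i) T (h θ))

/-- The draws of the stick-breaking Monte Carlo scheme: all the breaks `B i j` and all the atoms
`Z i j` are mutually independent, the breaks are `Beta (1, η)` and the atoms have law `q`. -/
structure IsStickBreakingSample {Ω X : Type*} [MeasurableSpace Ω] [MeasurableSpace X]
    (P : Measure Ω) (η : ℝ) (q : Measure X) (B : ℕ → ℕ → Ω → ℝ) (Z : ℕ → ℕ → Ω → X) : Prop where
  law_break : ∀ i j, HasLaw (B i j) (betaMeasure 1 η) P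
  law_atom : ∀ i j, HasLaw (Z i j) q P
  indep_break : iIndepFun (fun (k : ℕ × ℕ) => B k.1 k.2) P
  indep_atom : iIndepFun (fun (k : ℕ × ℕ) => Z k.1 k.2) P
  indep_break_atom : IndepFun (fun ω (k : ℕ × ℕ) => B k.1 k.2 ω)
    (fun ω (k : ℕ × ℕ) => Z k.1 k.2 ω) P

/-- The constant `C_T`: the expectation of `∑ j ≤ T, p_j c(ξ_j)`, where the `p_j` and `ξ_j` are
the weights and atoms of one truncated stick-breaking sample. -/
def lipschitzMean {Ω X : Type*} [MeasurableSpace Ω] (P : Measure Ω) (b : ℕ → Ω → ℝ)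
    (x : ℕ → Ω → X) (c : X → ℝ≥0) (T : ℕ) : ℝ≥0∞ :=
  ∫⁻ ω, ENNReal.ofReal
    (truncatedIntegral (fun j => b j ω) (fun j => x j ω) T fun y => (c y : ℝ)) ∂P

/-- `θ` is a minimizer of `f` over `S`. -/
def IsMinimizer {E : Type*} (f : E → ℝ) (S : Set E) (θ : E) : Prop :=
  θ ∈ S ∧ IsMinOn f S θ

end

/-! Write `η = α + n`. Under `DP (η, q)` the mean `M = ∫ h dp` solves `M = b h(x) + (1 - b) M` in
law, with `b ~ Beta (1, η)`, `x ~ q` and `M` independent on the right. Only moments are needed: for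
simple `h`, `M` is a linear form of a Dirichlet vector, and its moments are those of the same form
of independent Gamma variables divided by rising factorials of `η`. The generating function `∏ (1 -
t f i) ^ (-a i)` of the Gamma form has an explicit logarithmic derivative, which gives a moment
recursion whose coefficients are Beta moments (`IsDirichletProcess.integral_pow`). Hence the
equation holds against all polynomials (`IsDirichletProcess.integral_polynomial`).

Iterating it along `T` breaks yields the stick-breaking sum plus the remaining stick times an
independent `M`. The truncated scheme puts `h (x 0)` there instead of `M`, so a polynomial with
Lipschitz constant `L` has bias at most `L K (η / (η + 1)) ^ T`
(`abs_integral_polynomial_sub_criterion_le`).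

For uniformity, `φ` is replaced by a polynomial (Weierstrass) and a truncation `S` with small bias
is fixed. All `T ≥ S` are compared with `S` through the average remaining stick, and all `θ` with a
finite net through the average of the truncated Lipschitz constants. The strong law is then applied
only to finitely many averages at truncation `S`, which gives one rank valid for all large `T` and
`N`. Convergence of minima follows from uniform convergence. -/

/-! ### Gamma laws: exponential tilting is scaling. -/

theorem isProbabilityMeasure_gammaShape {a : ℝ} (ha : 0 ≤ a) :
    IsProbabilityMeasure (gammaShape a) := by
  unfold gammaShape
  split_ifs with h
  · infer_instance
  · exact isProbabilityMeasure_gammaMeasure (lt_of_le_of_ne ha (Ne.symm h)) one_pos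

theorem ae_nonneg_gammaShape (a : ℝ) : ∀ᵐ x ∂gammaShape a, 0 ≤ x := by
  unfold gammaShape
  split_ifs with h
  · simp [ae_dirac_eq]
  · rw [gammaMeasure, ae_withDensity_iff (by unfold gammaPDF; fun_prop)]
    refine ae_of_all _ fun x hx => ?_
    by_contra hneg
    exact hx (gammaPDF_of_neg (not_le.1 hneg))

theorem gammaPDF_mul_exp {a c : ℝ} (hc : 0 < c) (x : ℝ) :
    gammaPDF a 1 x * ENNReal.ofReal (Real.exp ((1 - c) * x)) =
      ENNReal.ofReal (c ^ (-a)) * (ENNReal.ofReal c * gammaPDF a 1 (c * x)) := by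
  rcases lt_or_ge x 0 with hx | hx
  · rw [gammaPDF_of_neg hx, gammaPDF_of_neg (mul_neg_of_pos_of_neg hc hx)]
    simp
  · rw [gammaPDF_of_nonneg hx, gammaPDF_of_nonneg (mul_nonneg hc.le hx),
      ← ENNReal.ofReal_mul' (Real.exp_pos _).le, ← ENNReal.ofReal_mul hc.le,
      ← ENNReal.ofReal_mul (by positivity)]
    congr 1
    have h1 : (c * x) ^ (a - 1) = c ^ (a - 1) * x ^ (a - 1) := Real.mul_rpow hc.le hx
    have h2 : c ^ (-a) * (c * c ^ (a - 1)) = 1 := by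
      rw [Real.rpow_sub_one hc.ne', mul_div_cancel₀ _ hc.ne', ← Real.rpow_add hc]
      simp
    have h3 : Real.exp (-(1 * x)) * Real.exp ((1 - c) * x) = Real.exp (-(1 * (c * x))) := by
      rw [← Real.exp_add]; ring_nf
    rw [h1, ← h3]
    linear_combination (-1 : ℝ) * (1 ^ a / Real.Gamma a * x ^ (a - 1) * (Real.exp (-(1 * x)) *
      Real.exp ((1 - c) * x))) * h2

/-- Tilting changes the rate from `1` to `c`, and rate `c` is the law of `x / c`; the mass gained is
`c ^ (-a)`. For shape `0` both sides are `F 0`. -/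
theorem lintegral_gammaShape_mul_exp {a c : ℝ} (hc : 0 < c) {F : ℝ → ℝ≥0∞} (hF : Measurable F) :
    ∫⁻ x, F x * ENNReal.ofReal (Real.exp ((1 - c) * x)) ∂gammaShape a =
      ENNReal.ofReal (c ^ (-a)) * ∫⁻ x, F (x / c) ∂gammaShape a := by
  unfold gammaShape
  split_ifs with h
  · subst h
    rw [lintegral_dirac' _ (by fun_prop), lintegral_dirac' _ (by fun_prop)]
    simp
  · have hpdf : Measurable (gammaPDF a 1) := by unfold gammaPDF; fun_prop
    rw [gammaMeasure, lintegral_withDensity_eq_lintegral_mul _ hpdf (by fun_prop),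
      lintegral_withDensity_eq_lintegral_mul _ hpdf (by fun_prop)]
    have hmap : (volume : Measure ℝ) =
        ENNReal.ofReal c • Measure.map (fun x => c * x) volume := by
      rw [Real.map_volume_mul_left hc.ne', smul_smul, ← ENNReal.ofReal_mul hc.le,
        abs_of_pos (inv_pos.2 hc), mul_inv_cancel₀ hc.ne', ENNReal.ofReal_one, one_smul]
    conv_rhs => rw [hmap]
    rw [lintegral_smul_measure, lintegral_map (by fun_prop) (by fun_prop), smul_eq_mul,
      ← lintegral_const_mul _ (by fun_prop), ← lintegral_const_mul _ (by fun_prop)]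
    refine lintegral_congr fun x => ?_
    have := gammaPDF_mul_exp (a := a) hc x
    simp only [Pi.mul_apply, mul_div_cancel_left₀ x hc.ne']
    rw [mul_left_comm, this]
    ring

theorem withDensity_exp_gammaShape {a c : ℝ} (hc : 0 < c) :
    (gammaShape a).withDensity (fun x => ENNReal.ofReal (Real.exp ((1 - c) * x))) =
      ENNReal.ofReal (c ^ (-a)) • (gammaShape a).map (fun x => x / c) := by
  refine Measure.ext fun s hs => ?_
  have h := lintegral_gammaShape_mul_exp (a := a) hc (F := s.indicator 1)
    (measurable_one.indicator hs)
  rw [withDensity_apply _ hs, Measure.smul_apply, Measure.map_apply (by fun_prop) hs,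
    smul_eq_mul, ← lintegral_indicator hs]
  have h2 : ∫⁻ x, s.indicator 1 (x / c) ∂gammaShape a =
      gammaShape a ((fun x => x / c) ⁻¹' s) := by
    rw [← lintegral_indicator_one (measurableSet_preimage (by fun_prop) hs)]
    rfl
  rw [← h2, ← h]
  refine lintegral_congr fun x => ?_
  by_cases hx : x ∈ s <;> simp [hx]

section Vector

variable {k : ℕ} {a : Fin k → ℝ}

/-- The coordinates tilt independently and by the same scale. For scale-invariant `F` this stands in
for the independence of the total and the proportions of a Gamma vector. -/
theorem lintegral_pi_gammaShape_mul_exp (ha : ∀ i, 0 ≤ a i) {c : ℝ} (hc : 0 < c)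
    {F : (Fin k → ℝ) → ℝ≥0∞} (hF : Measurable F) :
    ∫⁻ x, F x * ENNReal.ofReal (Real.exp ((1 - c) * ∑ i, x i))
        ∂Measure.pi (fun i => gammaShape (a i)) =
      ENNReal.ofReal (c ^ (-∑ i, a i)) * ∫⁻ x, F (fun i => x i / c)
        ∂Measure.pi (fun i => gammaShape (a i)) := by
  have hp : ∀ i, IsProbabilityMeasure (gammaShape (a i)) := fun i =>
    isProbabilityMeasure_gammaShape (ha i)
  set π := Measure.pi (fun i => gammaShape (a i))
  set e : ℝ → ℝ≥0∞ := fun x => ENNReal.ofReal (Real.exp ((1 - c) * x))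
  have hem : Measurable e := by fun_prop
  have hmp : ∀ i, IsProbabilityMeasure ((gammaShape (a i)).map (fun x => x / c)) := fun i =>
    Measure.isProbabilityMeasure_map (by fun_prop)
  have hprod : ∀ x : Fin k → ℝ,
      ENNReal.ofReal (Real.exp ((1 - c) * ∑ i, x i)) = ∏ i, e (x i) := by
    intro x
    rw [Finset.mul_sum, Real.exp_sum, ENNReal.ofReal_prod_of_nonneg
      (fun i _ => (Real.exp_pos _).le)]
  have hsf : ∀ i, IsFiniteMeasure
      (ENNReal.ofReal (c ^ (-a i)) • (gammaShape (a i)).map (fun x => x / c)) := fun i =>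
    Measure.smul_finite _ ENNReal.ofReal_ne_top
  -- `key1` and `key2` identify one product measure in two ways, as a tilt and as a scaled image, by
  -- testing on boxes.
  have key1 : Measure.pi (fun i => ENNReal.ofReal (c ^ (-a i)) •
      (gammaShape (a i)).map (fun x => x / c)) = π.withDensity fun x => ∏ i, e (x i) := by
    refine Measure.pi_eq fun s hs => ?_
    rw [withDensity_apply _ (MeasurableSet.univ_pi hs),
      ← lintegral_indicator (MeasurableSet.univ_pi hs)]
    have h1 : ∀ x : Fin k → ℝ, (univ.pi s).indicator (fun x => ∏ i, e (x i)) x =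
        ∏ i, (s i).indicator e (x i) := by
      intro x
      by_cases hx : x ∈ univ.pi s
      · rw [indicator_of_mem hx]
        exact Finset.prod_congr rfl fun i _ => (indicator_of_mem (hx i (mem_univ i)) _).symm
      · rw [indicator_of_notMem hx]
        simp only [Set.mem_pi, mem_univ, forall_true_left, not_forall] at hx
        obtain ⟨i, hi⟩ := hx
        exact (Finset.prod_eq_zero (Finset.mem_univ i) (indicator_of_notMem hi _)).symm
    simp_rw [h1]
    have hind : iIndepFun (fun i (x : Fin k → ℝ) => (s i).indicator e (x i)) π :=
      iIndepFun_pi (X := fun i => (s i).indicator e)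
        fun i => (hem.indicator (hs i)).aemeasurable
    rw [lintegral_prod_eq_prod_lintegral_of_indepFun _ _ hind
      (fun i => (hem.indicator (hs i)).comp (measurable_pi_apply i))]
    refine Finset.prod_congr rfl fun i _ => ?_
    rw [← withDensity_exp_gammaShape hc, withDensity_apply _ (hs i),
      ← lintegral_indicator (hs i)]
    exact (measurePreserving_eval (fun i => gammaShape (a i)) i).lintegral_comp
      (hem.indicator (hs i))
  have key2 : Measure.pi (fun i => ENNReal.ofReal (c ^ (-a i)) •
      (gammaShape (a i)).map (fun x => x / c)) =
      ENNReal.ofReal (c ^ (-∑ i, a i)) • π.map fun x i => x i / c := by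
    refine Measure.pi_eq fun s hs => ?_
    rw [Measure.smul_apply, Measure.pi_map_pi (f := fun _ x => x / c) (fun i => by fun_prop),
      Measure.pi_pi]
    simp only [Measure.smul_apply, smul_eq_mul, Finset.prod_mul_distrib]
    rw [← ENNReal.ofReal_prod_of_nonneg (fun i _ => by positivity), ← Finset.sum_neg_distrib,
      Real.rpow_sum_of_pos hc]
  have hem' : Measurable fun x : Fin k → ℝ => ∏ i, e (x i) :=
    Finset.measurable_prod _ fun i _ => hem.comp (measurable_pi_apply i)
  have key : ∫⁻ x, F x ∂(π.withDensity fun x => ∏ i, e (x i)) = ∫⁻ x, F x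
      ∂(ENNReal.ofReal (c ^ (-∑ i, a i)) • π.map fun x i => x i / c) := by
    rw [← key1, key2]
  rw [lintegral_withDensity_eq_lintegral_mul _ hem' hF, lintegral_smul_measure,
    lintegral_map hF (by fun_prop)] at key
  simp_rw [hprod]
  simpa [mul_comm] using key

theorem ae_nonneg_pi_gammaShape (ha : ∀ i, 0 ≤ a i) :
    ∀ᵐ x ∂Measure.pi (fun i => gammaShape (a i)), ∀ i, 0 ≤ x i := by
  have hp : ∀ i, IsProbabilityMeasure (gammaShape (a i)) := fun i =>
    isProbabilityMeasure_gammaShape (ha i)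
  rw [ae_all_iff]
  exact fun i => (measurePreserving_eval (fun i => gammaShape (a i)) i).quasiMeasurePreserving.ae
    (ae_nonneg_gammaShape (a i))

end Vector

/-! ### Moments of Gamma vectors from generating functions. -/

/-- The rising factorial `a (a + 1) ⋯ (a + r - 1)`. -/
noncomputable abbrev risingFactorial (a : ℝ) (r : ℕ) : ℝ := (ascPochhammer ℝ r).eval a

theorem risingFactorial_pos {a : ℝ} (ha : 0 < a) (r : ℕ) : 0 < risingFactorial a r :=
  ascPochhammer_pos r a ha

/-- Equality in a neighbourhood of `0`, not just at `0`, lets the induction differentiate once more.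
-/
theorem iteratedDeriv_one_sub_mul_rpow_eventuallyEq (a f : ℝ) (r : ℕ) :
    iteratedDeriv r (fun t => (1 - t * f) ^ (-a)) =ᶠ[𝓝 0]
      fun t => risingFactorial a r * f ^ r * (1 - t * f) ^ (-a - r) := by
  induction r with
  | zero => simp [risingFactorial]
  | succ r ih =>
    have hpos : ∀ᶠ t : ℝ in 𝓝 0, 0 < 1 - t * f := by
      have : ContinuousAt (fun t : ℝ => 1 - t * f) 0 := by fun_prop
      exact this.eventually (lt_mem_nhds (by simp))
    rw [iteratedDeriv_succ]
    refine ih.deriv.trans ?_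
    filter_upwards [hpos] with t ht
    have h1 : HasDerivAt (fun t : ℝ => 1 - t * f) (-f) t := by
      simpa using ((hasDerivAt_id t).mul_const f).const_sub 1
    have h2 := (h1.rpow_const (p := -a - r) (Or.inl ht.ne')).const_mul
      (risingFactorial a r * f ^ r)
    rw [h2.deriv, risingFactorial, risingFactorial, ascPochhammer_succ_eval]
    push_cast
    rw [show -a - (r : ℝ) - 1 = -a - (r + 1) by ring]
    ring

theorem iteratedDeriv_one_sub_mul_rpow_zero (a f : ℝ) (r : ℕ) :
    iteratedDeriv r (fun t => (1 - t * f) ^ (-a)) 0 = risingFactorial a r * f ^ r := by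
  simpa using (iteratedDeriv_one_sub_mul_rpow_eventuallyEq a f r).eq_of_nhds

theorem zero_mem_interior_integrableExpSet {Ω : Type*} [MeasurableSpace Ω] {μ : Measure Ω}
    {X : Ω → ℝ} (h : ∀ᶠ t in 𝓝 (0 : ℝ), Integrable (fun ω => Real.exp (t * X ω)) μ) :
    0 ∈ interior (integrableExpSet X μ) :=
  mem_interior_iff_mem_nhds.2 h

section Vector

variable {k : ℕ} {a : Fin k → ℝ}

theorem lintegral_exp_sum_withDensity (ha : ∀ i, 0 ≤ a i) {F : (Fin k → ℝ) → ℝ≥0∞}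
    (hF : Measurable F) (hhom : ∀ c : ℝ, 0 < c → ∀ x, F (fun i => x i / c) = F x) {t : ℝ}
    (ht : t < 1) :
    ∫⁻ x, ENNReal.ofReal (Real.exp (t * ∑ i, x i))
        ∂(Measure.pi (fun i => gammaShape (a i))).withDensity F =
      ENNReal.ofReal ((1 - t) ^ (-∑ i, a i)) * ∫⁻ x, F x
        ∂Measure.pi (fun i => gammaShape (a i)) := by
  rw [lintegral_withDensity_eq_lintegral_mul _ hF (by fun_prop)]
  have := lintegral_pi_gammaShape_mul_exp ha (sub_pos.2 ht) hF
  simpa [hhom _ (sub_pos.2 ht)] using this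

/-- Under the measure with density `F`, scale invariance makes the generating function of the total
a multiple of `(1 - t) ^ (-∑ a i)`; its `r`-th derivative at `0` is the moment. -/
theorem integral_mul_sum_pow_pi_gammaShape (ha : ∀ i, 0 ≤ a i) {F : (Fin k → ℝ) → ℝ}
    (hF : Measurable F) (hF0 : ∀ᵐ x ∂Measure.pi (fun i => gammaShape (a i)), 0 ≤ F x)
    (hFi : Integrable F (Measure.pi (fun i => gammaShape (a i))))
    (hhom : ∀ c : ℝ, 0 < c → ∀ x, F (fun i => x i / c) = F x) (r : ℕ) :
    ∫ x, F x * (∑ i, x i) ^ r ∂Measure.pi (fun i => gammaShape (a i)) =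
      risingFactorial (∑ i, a i) r * ∫ x, F x ∂Measure.pi (fun i => gammaShape (a i)) := by
  set π := Measure.pi (fun i => gammaShape (a i)) with hπ
  set S : (Fin k → ℝ) → ℝ := fun x => ∑ i, x i with hS
  have hSm : Measurable S := by fun_prop
  set μ := π.withDensity (fun x => ENNReal.ofReal (F x)) with hμ
  have hfin : ∫⁻ x, ENNReal.ofReal (F x) ∂π ≠ ⊤ :=
    ((hasFiniteIntegral_iff_ofReal hF0).1 hFi.2).ne
  have hl : ∀ t < (1 : ℝ), ∫⁻ x, ENNReal.ofReal (Real.exp (t * S x)) ∂μ =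
      ENNReal.ofReal ((1 - t) ^ (-∑ i, a i)) * ∫⁻ x, ENNReal.ofReal (F x) ∂π := fun t ht =>
    lintegral_exp_sum_withDensity ha hF.ennreal_ofReal
      (fun c hc x => by rw [hhom c hc x]) ht
  have hint : ∀ t < (1 : ℝ), Integrable (fun x => Real.exp (t * S x)) μ := by
    intro t ht
    refine ⟨by fun_prop, ?_⟩
    rw [hasFiniteIntegral_iff_ofReal (ae_of_all _ fun x => (Real.exp_pos _).le), hl t ht]
    exact ENNReal.mul_lt_top ENNReal.ofReal_lt_top hfin.lt_top
  have hnear : ∀ᶠ t in 𝓝 (0 : ℝ), t < 1 := gt_mem_nhds one_pos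
  have hmgf : mgf S μ =ᶠ[𝓝 0]
      fun t => (∫ x, F x ∂π) * (1 - t * 1) ^ (-∑ i, a i) := by
    filter_upwards [hnear] with t ht
    rw [mgf, integral_eq_lintegral_of_nonneg_ae (ae_of_all _ fun x => (Real.exp_pos _).le)
      (by fun_prop), hl t ht, ENNReal.toReal_mul, ENNReal.toReal_ofReal
      (Real.rpow_nonneg (by linarith) _), integral_eq_lintegral_of_nonneg_ae hF0
      hF.aestronglyMeasurable, mul_one, mul_comm]
  have h1 := iteratedDeriv_mgf_zero
    (zero_mem_interior_integrableExpSet (hnear.mono hint)) r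
  have hcd : ContDiffAt ℝ r (fun t : ℝ => (1 - t * 1) ^ (-∑ i, a i)) 0 :=
    ContDiffAt.rpow_const_of_ne (by fun_prop) (by simp)
  rw [hmgf.iteratedDeriv_eq, iteratedDeriv_const_mul _ hcd,
    iteratedDeriv_one_sub_mul_rpow_zero, hμ,
    integral_withDensity_eq_integral_toReal_smul hF.ennreal_ofReal
      (ae_of_all _ fun _ => ENNReal.ofReal_lt_top)] at h1
  rw [mul_comm, one_pow, mul_one] at h1
  rw [h1]
  refine integral_congr_ae ?_
  filter_upwards [hF0] with x hx
  simp [ENNReal.toReal_ofReal hx, hS]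

theorem mgf_gammaShape {a : ℝ} (ha : 0 ≤ a) {t : ℝ} (ht : t < 1) :
    mgf id (gammaShape a) t = (1 - t) ^ (-a) := by
  have hp := isProbabilityMeasure_gammaShape ha
  have h := lintegral_gammaShape_mul_exp (a := a) (sub_pos.2 ht) (F := fun _ => 1)
    measurable_const
  rw [mgf, integral_eq_lintegral_of_nonneg_ae (ae_of_all _ fun x => (Real.exp_pos _).le)
    (by fun_prop)]
  simp only [one_mul, sub_sub_cancel, lintegral_const, measure_univ, mul_one] at h
  simp only [id_eq, h]
  exact ENNReal.toReal_ofReal (Real.rpow_nonneg (by linarith) _)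

theorem mgf_linear_pi_gammaShape (ha : ∀ i, 0 ≤ a i) (f : Fin k → ℝ) {t : ℝ}
    (ht : ∀ i, t * f i < 1) :
    mgf (fun x => ∑ i, f i * x i) (Measure.pi (fun i => gammaShape (a i))) t =
      ∏ i, (1 - t * f i) ^ (-a i) := by
  have hp : ∀ i, IsProbabilityMeasure (gammaShape (a i)) := fun i =>
    isProbabilityMeasure_gammaShape (ha i)
  have hind : iIndepFun (fun i (x : Fin k → ℝ) => f i * x i)
      (Measure.pi (fun i => gammaShape (a i))) :=
    iIndepFun_pi (X := fun i y => f i * y) fun i => by fun_prop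
  have h := hind.mgf_sum (t := t) (fun i => by fun_prop) Finset.univ
  have h1 : (∑ i, fun x : Fin k → ℝ => f i * x i) = fun x => ∑ i, f i * x i := by
    ext x; simp
  rw [← h1, h]
  refine Finset.prod_congr rfl fun i _ => ?_
  rw [mgf_const_mul]
  have h2 := (measurePreserving_eval (fun i => gammaShape (a i)) i).map_eq
  have h3 := mgf_id_map (μ := Measure.pi (fun i => gammaShape (a i)))
    (X := fun x : Fin k → ℝ => x i) (measurable_pi_apply i).aemeasurable
  rw [← h3]
  rw [show (fun x : Fin k → ℝ => x i) = Function.eval i from rfl, h2, mul_comm,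
    mgf_gammaShape (ha i) (ht i)]

theorem eventually_mul_lt_one (f : Fin k → ℝ) : ∀ᶠ t in 𝓝 (0 : ℝ), ∀ i, t * f i < 1 := by
  rw [eventually_all]
  intro i
  have : ContinuousAt (fun t : ℝ => t * f i) 0 := by fun_prop
  exact this.eventually (gt_mem_nhds (by simp))

theorem zero_mem_interior_integrableExpSet_linear (ha : ∀ i, 0 ≤ a i) (f : Fin k → ℝ) :
    0 ∈ interior (integrableExpSet (fun x => ∑ i, f i * x i)
      (Measure.pi (fun i => gammaShape (a i)))) := by
  refine zero_mem_interior_integrableExpSet ?_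
  filter_upwards [eventually_mul_lt_one f] with t ht
  -- Without integrability `mgf` takes the default value `0`, but the product formula, which needs
  -- no integrability, is positive.
  by_contra hn
  have h := mgf_linear_pi_gammaShape ha f ht
  rw [mgf_undef hn] at h
  exact (Finset.prod_pos fun i _ => Real.rpow_pos_of_pos (by linarith [ht i]) (-a i)).ne h

/-- This is the logarithmic derivative of `∏ (1 - t f i) ^ (-a i)`, valid where every factor is
positive. -/
theorem deriv_mgf_linear_pi_gammaShape (ha : ∀ i, 0 ≤ a i) (f : Fin k → ℝ) :
    deriv (mgf (fun x => ∑ i, f i * x i) (Measure.pi (fun i => gammaShape (a i)))) =ᶠ[𝓝 0]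
      fun t => mgf (fun x => ∑ i, f i * x i) (Measure.pi (fun i => gammaShape (a i))) t *
        ∑ i, (a i * f i) * (1 - t * f i) ^ (-1 : ℝ) := by
  have heq : mgf (fun x => ∑ i, f i * x i) (Measure.pi (fun i => gammaShape (a i))) =ᶠ[𝓝 0]
      fun t => Real.exp (∑ i, (-a i) * Real.log (1 - t * f i)) := by
    filter_upwards [eventually_mul_lt_one f] with t ht
    rw [mgf_linear_pi_gammaShape ha f ht, Real.exp_sum]
    refine Finset.prod_congr rfl fun i _ => ?_
    rw [Real.rpow_def_of_pos (by linarith [ht i]), mul_comm]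
  refine heq.deriv.trans ?_
  filter_upwards [heq, eventually_mul_lt_one f] with t ht1 ht
  rw [ht1]
  have hd : HasDerivAt (fun t => ∑ i, (-a i) * Real.log (1 - t * f i))
      (∑ i, (-a i) * (-f i / (1 - t * f i))) t := by
    refine HasDerivAt.fun_sum fun i _ => ?_
    have h1 : HasDerivAt (fun t : ℝ => 1 - t * f i) (-f i) t := by
      simpa using ((hasDerivAt_id t).mul_const (f i)).const_sub 1
    exact (h1.log (by linarith [ht i])).const_mul _
  rw [hd.exp.deriv]
  congr 1
  refine Finset.sum_congr rfl fun i _ => ?_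
  rw [Real.rpow_neg_one]
  ring

/-- Leibniz's rule for the logarithmic derivative identity at `0`; the factorial is the rising
factorial of `1`. -/
theorem integral_linear_pow_succ_pi_gammaShape (ha : ∀ i, 0 ≤ a i) (f : Fin k → ℝ) (r : ℕ) :
    ∫ x, (∑ i, f i * x i) ^ (r + 1) ∂Measure.pi (fun i => gammaShape (a i)) =
      ∑ j ∈ Finset.range (r + 1), (r.choose j : ℝ) *
        (∫ x, (∑ i, f i * x i) ^ j ∂Measure.pi (fun i => gammaShape (a i))) *
        ∑ i, a i * ((r - j).factorial * f i ^ (r - j + 1)) := by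
  have hmem := zero_mem_interior_integrableExpSet_linear ha f
  have hw : ∀ j : ℕ, ∫ x, (∑ i, f i * x i) ^ j ∂Measure.pi (fun i => gammaShape (a i)) =
      iteratedDeriv j
        (mgf (fun x => ∑ i, f i * x i) (Measure.pi (fun i => gammaShape (a i)))) 0 := by
    intro j
    rw [iteratedDeriv_mgf_zero hmem j]
    rfl
  simp_rw [hw]
  have hcd : ∀ n : ℕ, ∀ i, ContDiffAt ℝ n (fun t : ℝ => (1 - t * f i) ^ (-1 : ℝ)) 0 := fun n i =>
    ContDiffAt.rpow_const_of_ne (by fun_prop) (by simp)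
  rw [iteratedDeriv_succ', (deriv_mgf_linear_pi_gammaShape ha f).iteratedDeriv_eq,
    iteratedDeriv_fun_mul (analyticAt_mgf hmem).contDiffAt
      (ContDiffAt.sum fun i _ => contDiffAt_const.mul (hcd r i))]
  refine Finset.sum_congr rfl fun j _ => ?_
  congr 1
  rw [iteratedDeriv_fun_sum fun i _ => contDiffAt_const.mul (hcd _ i)]
  refine Finset.sum_congr rfl fun i _ => ?_
  rw [iteratedDeriv_const_mul _ (hcd _ i), iteratedDeriv_one_sub_mul_rpow_zero,
    risingFactorial, ascPochhammer_eval_one]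
  ring

/-- The moments of a linear form of a Dirichlet vector, compared with those of the same linear
form of the Gamma vector. -/
theorem risingFactorial_mul_integral_linear_pow_dirichletMeasure (ha : ∀ i, 0 ≤ a i)
    {f : Fin k → ℝ} (hf : ∀ i, 0 ≤ f i) (r : ℕ) :
    risingFactorial (∑ i, a i) r * ∫ y, (∑ i, f i * y i) ^ r ∂dirichletMeasure a =
      ∫ x, (∑ i, f i * x i) ^ r ∂Measure.pi (fun i => gammaShape (a i)) := by
  have hp : ∀ i, IsProbabilityMeasure (gammaShape (a i)) := fun i =>
    isProbabilityMeasure_gammaShape (ha i)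
  have hm : Measurable fun (g : Fin k → ℝ) i => g i / ∑ l, g l := by fun_prop
  rw [dirichletMeasure, integral_map hm.aemeasurable
    (by fun_prop : Measurable fun y : Fin k → ℝ => (∑ i, f i * y i) ^ r).aestronglyMeasurable]
  set F : (Fin k → ℝ) → ℝ := fun x => (∑ i, f i * (x i / ∑ l, x l)) ^ r with hF
  have hFm : Measurable F := by fun_prop
  have hle : ∀ x : Fin k → ℝ, (∀ i, 0 ≤ x i) → ∀ i, 0 ≤ x i / ∑ l, x l ∧ x i / ∑ l, x l ≤ 1 :=
    fun x hx i => ⟨div_nonneg (hx i) (Finset.sum_nonneg fun l _ => hx l),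
      div_le_one_of_le₀ (Finset.single_le_sum (fun l _ => hx l) (Finset.mem_univ i))
        (Finset.sum_nonneg fun l _ => hx l)⟩
  have hae := ae_nonneg_pi_gammaShape ha
  have h0 : ∀ᵐ x ∂Measure.pi (fun i => gammaShape (a i)), 0 ≤ F x := by
    filter_upwards [hae] with x hx
    exact pow_nonneg (Finset.sum_nonneg fun i _ => mul_nonneg (hf i) (hle x hx i).1) r
  have hi : Integrable F (Measure.pi (fun i => gammaShape (a i))) := by
    refine Integrable.of_bound hFm.aestronglyMeasurable ((∑ i, f i) ^ r) ?_
    filter_upwards [hae, h0] with x hx hx0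
    rw [Real.norm_of_nonneg hx0]
    refine pow_le_pow_left₀ (Finset.sum_nonneg fun i _ => mul_nonneg (hf i) (hle x hx i).1) ?_ r
    exact Finset.sum_le_sum fun i _ => mul_le_of_le_one_right (hf i) (hle x hx i).2
  rw [← integral_mul_sum_pow_pi_gammaShape ha hFm h0 hi]
  · refine integral_congr_ae ?_
    filter_upwards [hae] with x hx
    simp only [hF]
    rw [← mul_pow, Finset.sum_mul]
    congr 1
    refine Finset.sum_congr rfl fun i _ => ?_
    -- If the total vanishes, the quotients are `0` by convention, but so are all the nonnegative
    -- coordinates.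
    by_cases hs : ∑ l, x l = 0
    · have := (Finset.sum_eq_zero_iff_of_nonneg fun l _ => hx l).1 hs i (Finset.mem_univ i)
      simp [this]
    · field_simp
  · intro c hc x
    simp only [hF]
    congr 1
    refine Finset.sum_congr rfl fun i _ => ?_
    rw [← Finset.sum_div, div_div_div_cancel_right₀ hc.ne']

end Vector

/-! ### Beta moments and the Dirichlet moment recursion. -/

theorem Gamma_add_natCast {a : ℝ} (ha : 0 < a) (r : ℕ) :
    Real.Gamma (a + r) = risingFactorial a r * Real.Gamma a := by
  induction r with
  | zero => simp [risingFactorial]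
  | succ r ih =>
    rw [risingFactorial, ascPochhammer_succ_eval]
    push_cast
    rw [← add_assoc, Real.Gamma_add_one (by positivity), ih]
    ring

/-- The integrand times the density is a multiple of the `Beta (k + 1, η + l)` density, so the value
is a ratio of normalising constants. -/
theorem integral_pow_mul_one_sub_pow_betaMeasure {η : ℝ} (hη : 0 < η) (k l : ℕ) :
    ∫ b, b ^ k * (1 - b) ^ l ∂betaMeasure 1 η =
      η * k.factorial * risingFactorial η l / risingFactorial η (k + l + 1) := by
  have hpdf : ∀ α β : ℝ, Measurable (betaPDF α β) := fun α β => by unfold betaPDF; fun_prop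
  have hnn : ∀ {α β : ℝ}, 0 < α → 0 < β → ∀ b, 0 ≤ betaPDFReal α β b := by
    intro α β hα hβ b
    by_cases hb : 0 < b ∧ b < 1
    · exact (betaPDFReal_pos hb.1 hb.2 hα hβ).le
    · rw [betaPDFReal, if_neg hb]
  have hk : (0 : ℝ) < k + 1 := by positivity
  have hl : 0 < η + l := by positivity
  have hone : ∫ b, betaPDFReal (k + 1) (η + l) b = 1 := by
    rw [integral_eq_lintegral_of_nonneg_ae (ae_of_all _ (hnn hk hl))
      (measurable_betaPDFReal _ _).aestronglyMeasurable]
    exact (ENNReal.toReal_eq_one_iff _).2 (lintegral_betaPDF_eq_one hk hl)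
  rw [betaMeasure, integral_withDensity_eq_integral_toReal_smul (hpdf _ _)
    (ae_of_all _ fun _ => ENNReal.ofReal_lt_top)]
  have hpt : ∀ b : ℝ, (betaPDF 1 η b).toReal • (b ^ k * (1 - b) ^ l) =
      beta (k + 1) (η + l) / beta 1 η * betaPDFReal (k + 1) (η + l) b := by
    intro b
    rw [betaPDF, ENNReal.toReal_ofReal (hnn one_pos hη b), smul_eq_mul]
    unfold betaPDFReal
    split_ifs with hb
    · have h1 : (0 : ℝ) < 1 - b := by linarith [hb.2]
      have h2 := (beta_pos hk hl).ne'
      have h3 : b ^ ((k : ℝ) + 1 - 1) = b ^ k := by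
        rw [add_sub_cancel_right, Real.rpow_natCast]
      have h4 : (1 - b) ^ (η + l - 1) = (1 - b) ^ (η - 1) * (1 - b) ^ l := by
        rw [← Real.rpow_natCast, ← Real.rpow_add h1]; ring_nf
      rw [h3, h4, sub_self, Real.rpow_zero]
      field_simp
    · simp
  simp_rw [hpt]
  rw [integral_const_mul, hone, mul_one]
  have hG := (Real.Gamma_pos_of_pos hη).ne'
  have hP := (risingFactorial_pos hη (k + l + 1)).ne'
  have e1 : (k : ℝ) + 1 + (η + l) = η + ((k + l + 1 : ℕ) : ℝ) := by push_cast; ring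
  rw [beta, beta, e1, Gamma_add_natCast hη, Gamma_add_natCast hη, Real.Gamma_nat_eq_factorial,
    Real.Gamma_one, add_comm 1 η, Real.Gamma_add_one hη.ne']
  field_simp

theorem isProbabilityMeasure_dirichletMeasure {k : ℕ} {a : Fin k → ℝ} (ha : ∀ i, 0 ≤ a i) :
    IsProbabilityMeasure (dirichletMeasure a) := by
  have hp : ∀ i, IsProbabilityMeasure (gammaShape (a i)) := fun i =>
    isProbabilityMeasure_gammaShape (ha i)
  exact Measure.isProbabilityMeasure_map (by fun_prop)

/-- With `A = ∑ a i`, the last factor of the rising factorial on the left is `A + r`. Its `A` part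
is the term `j = r` on the right; its `r` part comes from the Gamma recursion. The result has the
shape of the `Beta (1, A)` moments. -/
theorem integral_linear_pow_dirichletMeasure {k : ℕ} {a : Fin k → ℝ} (ha : ∀ i, 0 ≤ a i)
    {f : Fin k → ℝ} (hf : ∀ i, 0 ≤ f i) (r : ℕ) :
    risingFactorial (∑ i, a i) (r + 1) * ∫ y, (∑ i, f i * y i) ^ r ∂dirichletMeasure a =
      ∑ j ∈ Finset.range (r + 1), (r.choose j : ℝ) * (r - j).factorial *
        (∑ i, a i * f i ^ (r - j)) *
        (risingFactorial (∑ i, a i) j * ∫ y, (∑ i, f i * y i) ^ j ∂dirichletMeasure a) := by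
  rw [risingFactorial, ascPochhammer_succ_eval, mul_right_comm]
  have hw := risingFactorial_mul_integral_linear_pow_dirichletMeasure ha hf
  simp_rw [hw]
  rw [Finset.sum_range_succ]
  simp only [Nat.choose_self, Nat.cast_one, tsub_self, Nat.factorial_zero, pow_zero, mul_one,
    one_mul]
  have : (r : ℝ) * ∫ x, (∑ i, f i * x i) ^ r ∂Measure.pi (fun i => gammaShape (a i)) =
      ∑ j ∈ Finset.range r, (r.choose j : ℝ) * (r - j).factorial * (∑ i, a i * f i ^ (r - j)) *
        ∫ x, (∑ i, f i * x i) ^ j ∂Measure.pi (fun i => gammaShape (a i)) := by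
    cases r with
    | zero => simp
    | succ s =>
      rw [integral_linear_pow_succ_pi_gammaShape ha f s, Finset.mul_sum]
      refine Finset.sum_congr rfl fun j hj => ?_
      have hjs : j ≤ s := Nat.lt_succ_iff.1 (Finset.mem_range.1 hj)
      have h1 : (((s + 1).choose j : ℕ) : ℝ) * ((s + 1 - j).factorial : ℕ) =
          (s + 1 : ℕ) * (s.choose j : ℕ) * ((s - j).factorial : ℕ) := by
        have h2 := Nat.choose_mul_succ_eq s j
        rw [Nat.succ_sub hjs] at h2 ⊢
        rw [Nat.factorial_succ]
        norm_cast
        rw [← mul_assoc, ← Nat.succ_eq_add_one (s - j), ← h2]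
        ring
      rw [h1, Nat.succ_sub hjs]
      simp_rw [mul_left_comm (a _) (((s - j).factorial : ℕ) : ℝ), ← Finset.mul_sum]
      ring
  rw [← this]
  ring

/-! ### Moments of means under a Dirichlet process. -/

section DirichletProcess

variable {X : Type*} [MeasurableSpace X] {η : ℝ} {q : Measure X} {Q : Measure (ProbabilityMeasure X)}

theorem measurable_integral_probabilityMeasure {h : X → ℝ} (hm : Measurable h)
    (h0 : ∀ x, 0 ≤ h x) :
    Measurable fun p : ProbabilityMeasure X => ∫ x, h x ∂(p : Measure X) := by
  have : (fun p : ProbabilityMeasure X => ∫ x, h x ∂(p : Measure X)) =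
      fun p : ProbabilityMeasure X => (∫⁻ x, ENNReal.ofReal (h x) ∂(p : Measure X)).toReal := by
    funext p
    exact integral_eq_lintegral_of_nonneg_ae (ae_of_all _ h0) hm.aestronglyMeasurable
  rw [this]
  exact ((Measure.measurable_lintegral hm.ennreal_ofReal).comp measurable_subtype_coe).ennreal_toReal

theorem integral_mem_Icc {K : ℝ} {h : X → ℝ} (hm : Measurable h) (hK : ∀ x, h x ∈ Icc 0 K)
    (p : Measure X) [IsProbabilityMeasure p] : ∫ x, h x ∂p ∈ Icc 0 K := by
  refine ⟨integral_nonneg fun x => (hK x).1, ?_⟩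
  have hi : Integrable h p := Integrable.of_mem_Icc 0 K hm.aemeasurable (ae_of_all _ hK)
  simpa using integral_mono hi (integrable_const K) fun x => (hK x).2

/-- The partition into one block suffices, since its Dirichlet law is a probability measure. -/
theorem IsDirichletProcess.isProbabilityMeasure [IsProbabilityMeasure q] (hη : 0 < η)
    (hQ : IsDirichletProcess η q Q) : IsProbabilityMeasure Q := by
  have h := hQ 1 (fun _ => univ) (fun _ => .univ)
    (fun i j hij => (hij (Subsingleton.elim i j)).elim) (iUnion_const _)
  have hd := isProbabilityMeasure_dirichletMeasure (a := fun _ : Fin 1 => η * q.real univ)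
    fun _ => by simp [hη.le]
  exact h.isProbabilityMeasure_iff.2 hd

/-- The moments of the mean of a nonnegative simple function under a Dirichlet process. -/
theorem IsDirichletProcess.integral_simpleFunc_pow [IsProbabilityMeasure q] (hη : 0 < η)
    (hQ : IsDirichletProcess η q Q) (s : SimpleFunc X ℝ) (hs : ∀ x, 0 ≤ s x) (r : ℕ) :
    ∫ p : ProbabilityMeasure X, (∫ x, s x ∂(p : Measure X)) ^ r ∂Q =
      ∑ j ∈ Finset.range (r + 1), (r.choose j : ℝ) *
        (∫ b, b ^ (r - j) * (1 - b) ^ j ∂betaMeasure 1 η) * (∫ x, s x ^ (r - j) ∂q) *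
        ∫ p : ProbabilityMeasure X, (∫ x, s x ∂(p : Measure X)) ^ j ∂Q := by
  classical
  let e := s.range.equivFin.symm
  -- On the partition into level sets, the mean of `s` is a linear form of a Dirichlet vector.
  let A : Fin s.range.card → Set X := fun i => s ⁻¹' {(e i : ℝ)}
  have hAm : ∀ i, MeasurableSet (A i) := fun i => s.measurableSet_preimage _
  have hdisj : Pairwise fun i j => Disjoint (A i) (A j) := by
    intro i j hij
    refine Disjoint.preimage _ (disjoint_singleton.2 fun h => hij ?_)
    exact e.injective (Subtype.ext h)
  have hunion : (⋃ i, A i) = univ := by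
    refine eq_univ_of_forall fun x => mem_iUnion.2 ⟨e.symm ⟨s x, s.mem_range_self x⟩, ?_⟩
    simp [A]
  have hlaw := hQ _ A hAm hdisj hunion
  have hsum : ∀ (p : Measure X) [IsProbabilityMeasure p] (k : ℕ),
      ∫ x, s x ^ k ∂p = ∑ i, (e i : ℝ) ^ k * p.real (A i) := by
    intro p _ k
    have h1 : ∀ x, s x ^ k = ∑ i, (A i).indicator (fun _ => (e i : ℝ) ^ k) x := by
      intro x
      rw [Finset.sum_eq_single (e.symm ⟨s x, s.mem_range_self x⟩)]
      · rw [indicator_of_mem (by simp [A])]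
        simp
      · intro i _ hi
        refine indicator_of_notMem (fun hx => hi ?_) _
        rw [Equiv.eq_symm_apply]
        exact Subtype.ext (mem_singleton_iff.1 hx).symm
      · simp
    simp_rw [h1]
    rw [integral_finsetSum _ fun i _ => (integrable_const _).indicator (hAm i)]
    refine Finset.sum_congr rfl fun i _ => ?_
    rw [integral_indicator_const _ (hAm i), smul_eq_mul, mul_comm]
  have hsum1 : ∀ p : ProbabilityMeasure X,
      ∫ x, s x ∂(p : Measure X) = ∑ i, (e i : ℝ) * (p : Measure X).real (A i) := fun p => by
    simpa using hsum (p : Measure X) 1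
  have hmom : ∀ k : ℕ, ∫ p : ProbabilityMeasure X, (∫ x, s x ∂(p : Measure X)) ^ k ∂Q =
      ∫ y, (∑ i, (e i : ℝ) * y i) ^ k ∂dirichletMeasure fun i => η * q.real (A i) := by
    intro k
    simp_rw [hsum1]
    exact hlaw.integral_comp (f := fun y => (∑ i, (e i : ℝ) * y i) ^ k)
      (by fun_prop : Measurable fun y : Fin s.range.card → ℝ =>
        (∑ i, (e i : ℝ) * y i) ^ k).aestronglyMeasurable
  have ha : ∀ i, 0 ≤ η * q.real (A i) := fun i => mul_nonneg hη.le measureReal_nonneg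
  have htot : ∑ i, η * q.real (A i) = η := by
    have := hsum q 0
    simp only [pow_zero, one_mul, integral_const, probReal_univ, smul_eq_mul, mul_one] at this
    rw [← Finset.mul_sum, ← this, mul_one]
  have hf : ∀ i, 0 ≤ (e i : ℝ) := by
    intro i
    obtain ⟨x, hx⟩ := SimpleFunc.mem_range.1 (e i).2
    exact hx ▸ hs x
  have hmain := integral_linear_pow_dirichletMeasure ha hf r
  rw [htot] at hmain
  simp_rw [hmom]
  have hP := (risingFactorial_pos hη (r + 1)).ne'
  rw [← mul_right_inj' hP, hmain, Finset.mul_sum]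
  refine Finset.sum_congr rfl fun j hj => ?_
  have hjr : j ≤ r := Nat.lt_succ_iff.1 (Finset.mem_range.1 hj)
  rw [integral_pow_mul_one_sub_pow_betaMeasure hη, hsum q, Nat.sub_add_cancel hjr]
  simp_rw [mul_assoc η, ← Finset.mul_sum, mul_comm (q.real _)]
  field_simp

/-- The moments of the mean of a bounded measurable function under a Dirichlet process. -/
theorem IsDirichletProcess.integral_pow [IsProbabilityMeasure q] (hη : 0 < η)
    (hQ : IsDirichletProcess η q Q) {K : ℝ} {h : X → ℝ} (hm : Measurable h)
    (hK : ∀ x, h x ∈ Icc 0 K) (r : ℕ) :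
    ∫ p : ProbabilityMeasure X, (∫ x, h x ∂(p : Measure X)) ^ r ∂Q =
      ∑ j ∈ Finset.range (r + 1), (r.choose j : ℝ) *
        (∫ b, b ^ (r - j) * (1 - b) ^ j ∂betaMeasure 1 η) * (∫ x, h x ^ (r - j) ∂q) *
        ∫ p : ProbabilityMeasure X, (∫ x, h x ∂(p : Measure X)) ^ j ∂Q := by
  have hQp := hQ.isProbabilityMeasure hη
  obtain ⟨x₀⟩ : Nonempty X := nonempty_of_isProbabilityMeasure q
  have hK0 : (0 : ℝ) ∈ Icc 0 K := ⟨le_rfl, (hK x₀).1.trans (hK x₀).2⟩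
  -- The approximants stay in `[0, K]`, so dominated convergence applies under `q`, under each `p`
  -- and under `Q`.
  let s : ℕ → SimpleFunc X ℝ := SimpleFunc.approxOn h hm (Icc 0 K) 0 hK0
  have hsK : ∀ n x, s n x ∈ Icc 0 K := fun n x => SimpleFunc.approxOn_mem hm hK0 n x
  have hst : ∀ x, Tendsto (fun n => s n x) atTop (𝓝 (h x)) := fun x =>
    SimpleFunc.tendsto_approxOn hm hK0 (subset_closure (hK x))
  have habs : ∀ {y : ℝ} (k : ℕ), y ∈ Icc 0 K → ‖y ^ k‖ ≤ K ^ k := fun k hy => by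
    rw [Real.norm_of_nonneg (pow_nonneg hy.1 k)]
    exact pow_le_pow_left₀ hy.1 hy.2 k
  have hlim : ∀ (p : Measure X) [IsProbabilityMeasure p] (k : ℕ),
      Tendsto (fun n => ∫ x, s n x ^ k ∂p) atTop (𝓝 (∫ x, h x ^ k ∂p)) := by
    intro p _ k
    refine tendsto_integral_of_dominated_convergence (fun _ => K ^ k)
      (fun n => ((s n).measurable.pow_const k).aestronglyMeasurable) (integrable_const _)
      (fun n => ae_of_all _ fun x => habs k (hsK n x)) (ae_of_all _ fun x => (hst x).pow k)
  have hlimQ : ∀ k : ℕ,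
      Tendsto (fun n => ∫ p : ProbabilityMeasure X, (∫ x, s n x ∂(p : Measure X)) ^ k ∂Q) atTop
        (𝓝 (∫ p : ProbabilityMeasure X, (∫ x, h x ∂(p : Measure X)) ^ k ∂Q)) := by
    intro k
    refine tendsto_integral_of_dominated_convergence (fun _ => K ^ k)
      (fun n => ((measurable_integral_probabilityMeasure (s n).measurable
        fun x => (hsK n x).1).pow_const k).aestronglyMeasurable) (integrable_const _)
      (fun n => ae_of_all _ fun p => habs k (integral_mem_Icc (s n).measurable (hsK n) _))
      (ae_of_all _ fun p => ?_)
    simpa using (hlim (p : Measure X) 1).pow k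
  refine tendsto_nhds_unique (hlimQ r) ?_
  simp_rw [fun n => hQ.integral_simpleFunc_pow hη (s n) (fun x => (hsK n x).1) r]
  exact tendsto_finsetSum _ fun j _ =>
    ((tendsto_const_nhds.mul (hlim q (r - j))).mul (hlimQ j))

end DirichletProcess

/-! ### The distributional equation tested on polynomials. -/

section FixedPoint

variable {X : Type*} [MeasurableSpace X] {K : ℝ}

theorem convexCombination_mem_Icc {b x y : ℝ} (hb : b ∈ Icc (0 : ℝ) 1) (hx : x ∈ Icc 0 K)
    (hy : y ∈ Icc 0 K) : b * x + (1 - b) * y ∈ Icc 0 K :=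
  convex_Icc 0 K hx hy hb.1 (sub_nonneg.2 hb.2) (add_sub_cancel b 1)

theorem Polynomial.exists_bound_Icc (p : Polynomial ℝ) (K : ℝ) :
    ∃ C, ∀ y ∈ Icc 0 K, ‖p.eval y‖ ≤ C :=
  isCompact_Icc.exists_bound_of_continuousOn p.continuous.continuousOn

/-- A law `ν` on `[0, K]` whose moments satisfy the recursion of the equation
`M = b h(x) + (1 - b) M` in distribution satisfies this equation for all polynomials. -/
theorem integral_polynomial_eq_of_moments {β : Measure ℝ} [IsProbabilityMeasure β]
    (hβ : ∀ᵐ b ∂β, b ∈ Icc (0 : ℝ) 1) {q : Measure X} [IsProbabilityMeasure q]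
    {ν : Measure ℝ} [IsProbabilityMeasure ν] (hν : ∀ᵐ m ∂ν, m ∈ Icc 0 K)
    {h : X → ℝ} (hm : Measurable h) (hK : ∀ x, h x ∈ Icc 0 K)
    (hmom : ∀ r : ℕ, ∫ m, m ^ r ∂ν = ∑ j ∈ Finset.range (r + 1), (r.choose j : ℝ) *
      (∫ b, b ^ (r - j) * (1 - b) ^ j ∂β) * (∫ x, h x ^ (r - j) ∂q) * ∫ m, m ^ j ∂ν)
    (p : Polynomial ℝ) :
    ∫ m, p.eval m ∂ν =
      ∫ w, p.eval (w.1.1 * h w.1.2 + (1 - w.1.1) * w.2) ∂((β.prod q).prod ν) := by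
  have hae : ∀ᵐ w ∂((β.prod q).prod ν),
      w.1.1 * h w.1.2 + (1 - w.1.1) * w.2 ∈ Icc 0 K := by
    have h1 : ∀ᵐ w ∂((β.prod q).prod ν), w.1.1 ∈ Icc (0 : ℝ) 1 :=
      (Measure.quasiMeasurePreserving_fst.comp Measure.quasiMeasurePreserving_fst).ae hβ
    have h2 : ∀ᵐ w ∂((β.prod q).prod ν), w.2 ∈ Icc 0 K :=
      Measure.quasiMeasurePreserving_snd.ae hν
    filter_upwards [h1, h2] with w hw1 hw2
    exact convexCombination_mem_Icc hw1 (hK _) hw2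
  have hi1 : ∀ p : Polynomial ℝ, Integrable (fun m => p.eval m) ν := by
    intro p
    obtain ⟨C, hC⟩ := p.exists_bound_Icc K
    exact Integrable.of_bound p.continuous.measurable.aestronglyMeasurable C
      (hν.mono fun m hm => hC m hm)
  have hi2 : ∀ p : Polynomial ℝ, Integrable
      (fun w : (ℝ × X) × ℝ => p.eval (w.1.1 * h w.1.2 + (1 - w.1.1) * w.2))
      ((β.prod q).prod ν) := by
    intro p
    obtain ⟨C, hC⟩ := p.exists_bound_Icc K
    exact Integrable.of_bound (p.continuous.measurable.comp
      (by fun_prop)).aestronglyMeasurable C (hae.mono fun w hw => hC _ hw)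
  induction p using Polynomial.induction_on' with
  | add p₁ p₂ h₁ h₂ =>
    simp only [Polynomial.eval_add]
    rw [integral_add (hi1 p₁) (hi1 p₂), integral_add (hi2 p₁) (hi2 p₂), h₁, h₂]
  | monomial r c =>
    simp only [Polynomial.eval_monomial]
    rw [integral_const_mul, integral_const_mul, hmom]
    congr 1
    -- In the binomial expansion each term is a product over the three independent variables, which
    -- turns the right side into the moment recursion.
    have hexp : ∀ w : (ℝ × X) × ℝ, (w.1.1 * h w.1.2 + (1 - w.1.1) * w.2) ^ r =
        ∑ j ∈ Finset.range (r + 1), (r.choose j : ℝ) *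
          ((w.1.1 ^ (r - j) * (1 - w.1.1) ^ j) * h w.1.2 ^ (r - j) * w.2 ^ j) := by
      intro w
      rw [add_comm, add_pow]
      refine Finset.sum_congr rfl fun j _ => ?_
      rw [mul_pow, mul_pow]
      ring
    have hbb : Integrable (fun x => h x) q :=
      Integrable.of_mem_Icc 0 K hm.aemeasurable (ae_of_all _ hK)
    have hint : ∀ j ∈ Finset.range (r + 1), Integrable (fun w : (ℝ × X) × ℝ =>
        (r.choose j : ℝ) *
          ((w.1.1 ^ (r - j) * (1 - w.1.1) ^ j) * h w.1.2 ^ (r - j) * w.2 ^ j))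
        ((β.prod q).prod ν) := by
      intro j _
      refine Integrable.const_mul ?_ _
      refine Integrable.mul_prod (f := fun z : ℝ × X =>
        (z.1 ^ (r - j) * (1 - z.1) ^ j) * h z.2 ^ (r - j)) (g := fun m : ℝ => m ^ j) ?_ ?_
      · refine Integrable.mul_prod (f := fun b : ℝ => b ^ (r - j) * (1 - b) ^ j)
          (g := fun x => h x ^ (r - j)) ?_ ?_
        · refine Integrable.of_bound (by fun_prop) 1 (hβ.mono fun b hb => ?_)
          have h1 : 0 ≤ 1 - b := sub_nonneg.2 hb.2
          have h2 : 1 - b ≤ 1 := by linarith [hb.1]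
          rw [Real.norm_of_nonneg (mul_nonneg (pow_nonneg hb.1 _) (pow_nonneg h1 _))]
          exact mul_le_one₀ (pow_le_one₀ hb.1 hb.2) (pow_nonneg h1 _) (pow_le_one₀ h1 h2)
        · refine Integrable.of_bound (by fun_prop) (K ^ (r - j)) (ae_of_all _ fun x => ?_)
          rw [Real.norm_of_nonneg (pow_nonneg (hK x).1 _)]
          exact pow_le_pow_left₀ (hK x).1 (hK x).2 _
      · simpa using hi1 (Polynomial.X ^ j)
    simp_rw [hexp]
    rw [integral_finsetSum _ hint]
    refine Finset.sum_congr rfl fun j _ => ?_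
    rw [integral_const_mul, integral_prod_mul (f := fun z : ℝ × X =>
        (z.1 ^ (r - j) * (1 - z.1) ^ j) * h z.2 ^ (r - j)) (g := fun m : ℝ => m ^ j),
      integral_prod_mul (f := fun b : ℝ => b ^ (r - j) * (1 - b) ^ j)
        (g := fun x => h x ^ (r - j))]
    ring

end FixedPoint

/-! ### Pathwise bounds for stick breaking. -/

section Stick

variable {X : Type*} {b : ℕ → ℝ} {x : ℕ → X} {f : X → ℝ} {K : ℝ}

/-- The length of the stick that is left after `T` breaks. -/
def stickRemainder (b : ℕ → ℝ) (T : ℕ) : ℝ := ∏ k ∈ Finset.range T, (1 - b k)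

/-- The part of the stick-breaking integral that is carried by the first `T` breaks. -/
def stickSum (b : ℕ → ℝ) (x : ℕ → X) (T : ℕ) (f : X → ℝ) : ℝ :=
  ∑ j ∈ Finset.range T, b j * (∏ k ∈ Finset.range j, (1 - b k)) * f (x (j + 1))

theorem truncatedIntegral_eq (b : ℕ → ℝ) (x : ℕ → X) (T : ℕ) (f : X → ℝ) :
    truncatedIntegral b x T f = stickRemainder b T * f (x 0) + stickSum b x T f := rfl

theorem stickRemainder_succ (b : ℕ → ℝ) (T : ℕ) :
    stickRemainder b (T + 1) = stickRemainder b T * (1 - b T) :=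
  Finset.prod_range_succ _ _

theorem stickSum_succ (b : ℕ → ℝ) (x : ℕ → X) (T : ℕ) (f : X → ℝ) :
    stickSum b x (T + 1) f = stickSum b x T f + stickRemainder b T * (b T * f (x (T + 1))) := by
  rw [stickSum, Finset.sum_range_succ, stickSum, stickRemainder]
  ring

theorem stickRemainder_nonneg (hb : ∀ j, b j ∈ Icc (0 : ℝ) 1) (T : ℕ) : 0 ≤ stickRemainder b T :=
  Finset.prod_nonneg fun j _ => sub_nonneg.2 (hb j).2

theorem stickRemainder_le_one (hb : ∀ j, b j ∈ Icc (0 : ℝ) 1) (T : ℕ) :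
    stickRemainder b T ≤ 1 :=
  Finset.prod_le_one (fun j _ => sub_nonneg.2 (hb j).2) fun j _ => by linarith [(hb j).1]

theorem monotone_stickSum (hb : ∀ j, b j ∈ Icc (0 : ℝ) 1) (hf : ∀ y, 0 ≤ f y) :
    Monotone fun T => stickSum b x T f :=
  monotone_nat_of_le_succ fun T => by
    rw [stickSum_succ]
    exact le_add_of_nonneg_right (mul_nonneg (stickRemainder_nonneg hb T)
      (mul_nonneg (hb T).1 (hf _)))

theorem antitone_stickSum_add (hb : ∀ j, b j ∈ Icc (0 : ℝ) 1) (hf : ∀ y, f y ≤ K) :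
    Antitone fun T => stickSum b x T f + stickRemainder b T * K :=
  antitone_nat_of_succ_le fun T => by
    rw [stickSum_succ, stickRemainder_succ]
    have := mul_le_mul_of_nonneg_left (mul_le_mul_of_nonneg_left (hf (x (T + 1))) (hb T).1)
      (stickRemainder_nonneg hb T)
    linarith

/-- Whatever happens after `S` breaks only redistributes the remaining stick among values in `[0,
K]`. Here `m` is the value put on the last piece: `f (x 0)` for the truncated scheme, a draw of the
mean for the exact one. -/
theorem stickSum_add_mem_Icc (hb : ∀ j, b j ∈ Icc (0 : ℝ) 1) (hf : ∀ y, f y ∈ Icc 0 K) {m : ℝ}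
    (hm : m ∈ Icc 0 K) {S T : ℕ} (hST : S ≤ T) :
    stickSum b x T f + stickRemainder b T * m ∈
      Icc (stickSum b x S f) (stickSum b x S f + stickRemainder b S * K) := by
  have h1 := monotone_stickSum (x := x) hb (fun y => (hf y).1) hST
  have h2 := antitone_stickSum_add (x := x) hb (fun y => (hf y).2) hST
  have h3 := stickRemainder_nonneg hb T
  simp only at h1 h2
  exact ⟨by nlinarith [mul_nonneg h3 hm.1], by nlinarith [mul_le_mul_of_nonneg_left hm.2 h3]⟩

theorem stickSum_add_mem_Icc_zero (hb : ∀ j, b j ∈ Icc (0 : ℝ) 1) (hf : ∀ y, f y ∈ Icc 0 K)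
    {m : ℝ} (hm : m ∈ Icc 0 K) (T : ℕ) :
    stickSum b x T f + stickRemainder b T * m ∈ Icc 0 K := by
  simpa [stickSum, stickRemainder] using stickSum_add_mem_Icc (x := x) hb hf hm (Nat.zero_le T)

theorem truncatedIntegral_mem_Icc (hb : ∀ j, b j ∈ Icc (0 : ℝ) 1) (hf : ∀ y, f y ∈ Icc 0 K)
    (T : ℕ) : truncatedIntegral b x T f ∈ Icc 0 K := by
  rw [truncatedIntegral_eq, add_comm]
  exact stickSum_add_mem_Icc_zero hb hf (hf _) T

theorem abs_sub_truncatedIntegral_le (hb : ∀ j, b j ∈ Icc (0 : ℝ) 1) (hf : ∀ y, f y ∈ Icc 0 K)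
    {S T : ℕ} (hST : S ≤ T) :
    |truncatedIntegral b x T f - truncatedIntegral b x S f| ≤ stickRemainder b S * K := by
  have h1 := stickSum_add_mem_Icc (x := x) hb hf (hf (x 0)) hST
  have h2 := stickSum_add_mem_Icc (x := x) hb hf (hf (x 0)) le_rfl (S := S)
  rw [truncatedIntegral_eq, truncatedIntegral_eq, abs_le]
  constructor <;> linarith [h1.1, h1.2, h2.1, h2.2]

theorem truncatedIntegral_nonneg (hb : ∀ j, b j ∈ Icc (0 : ℝ) 1) (hf : ∀ y, 0 ≤ f y) (T : ℕ) :
    0 ≤ truncatedIntegral b x T f :=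
  add_nonneg (mul_nonneg (stickRemainder_nonneg hb T) (hf _))
    (Finset.sum_nonneg fun j _ => mul_nonneg (mul_nonneg (hb j).1 (stickRemainder_nonneg hb j))
      (hf _))

theorem abs_truncatedIntegral_sub_le (hb : ∀ j, b j ∈ Icc (0 : ℝ) 1) {f g c : X → ℝ}
    (hfg : ∀ y, |f y - g y| ≤ c y) (T : ℕ) :
    |truncatedIntegral b x T f - truncatedIntegral b x T g| ≤ truncatedIntegral b x T c := by
  have h : truncatedIntegral b x T f - truncatedIntegral b x T g =
      truncatedIntegral b x T (fun y => f y - g y) := by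
    simp only [truncatedIntegral, mul_sub, Finset.sum_sub_distrib]
    ring
  rw [h]
  refine (abs_add_le _ _).trans (add_le_add ?_ ((Finset.abs_sum_le_sum_abs _ _).trans
    (Finset.sum_le_sum fun j _ => ?_)))
  · rw [abs_mul, abs_of_nonneg (Finset.prod_nonneg fun k _ => sub_nonneg.2 (hb k).2)]
    exact mul_le_mul_of_nonneg_left (hfg _) (stickRemainder_nonneg hb T)
  · have h0 := mul_nonneg (hb j).1 (stickRemainder_nonneg hb j)
    rw [stickRemainder] at h0
    rw [abs_mul, abs_of_nonneg h0]
    exact mul_le_mul_of_nonneg_left (hfg _) h0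

theorem truncatedIntegral_mul_const (b : ℕ → ℝ) (x : ℕ → X) (T : ℕ) (c : X → ℝ) (δ : ℝ) :
    truncatedIntegral b x T (fun y => c y * δ) = truncatedIntegral b x T c * δ := by
  simp only [truncatedIntegral, add_mul, Finset.sum_mul, mul_assoc]

end Stick

/-! ### Independence of pairs and of finite blocks; the law of large numbers for rows. -/

section Independence

variable {Ω : Type*} [MeasurableSpace Ω] {P : Measure Ω}

/-- Rectangles form a generating π-system. On them the probability splits first between the two
families, then over indices within each, and is regrouped index by index. -/
theorem ProbabilityTheory.iIndepFun.prodMk_of_indepFun {ι β γ : Type*} [MeasurableSpace β] [MeasurableSpace γ]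
    {f : ι → Ω → β} {g : ι → Ω → γ} (hf : iIndepFun f P) (hg : iIndepFun g P)
    (hfm : ∀ i, Measurable (f i)) (hgm : ∀ i, Measurable (g i))
    (hfg : IndepFun (fun ω i => f i ω) (fun ω i => g i ω) P) :
    iIndepFun (fun i ω => (f i ω, g i ω)) P := by
  let π : ι → Set (Set Ω) := fun i =>
    {s | ∃ u v, MeasurableSet u ∧ MeasurableSet v ∧ f i ⁻¹' u ∩ g i ⁻¹' v = s}
  refine iIndepSets.iIndep (fun i => ((hfm i).prodMk (hgm i)).comap_le) π ?_ ?_ ?_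
  · rintro i _ ⟨u, v, hu, hv, rfl⟩ _ ⟨u', v', hu', hv', rfl⟩ _
    refine ⟨u ∩ u', v ∩ v', hu.inter hu', hv.inter hv', ?_⟩
    ext ω
    simp only [mem_inter_iff, mem_preimage]
    tauto
  · intro i
    rw [← generateFrom_prod, MeasurableSpace.comap_generateFrom]
    congr 1
    ext s
    simp only [π, mem_image, image2, mem_ofPred_eq]
    constructor
    · rintro ⟨_, ⟨u, hu, v, hv, rfl⟩, rfl⟩
      exact ⟨u, v, hu, hv, rfl⟩
    · rintro ⟨u, v, hu, hv, rfl⟩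
      exact ⟨_, ⟨u, hu, v, hv, rfl⟩, rfl⟩
  · rw [iIndepSets_iff]
    intro S s hs
    choose! u v hu hv huv using hs
    have h1 := hf.measure_inter_preimage_eq_mul S (sets := u) hu
    have h2 := hg.measure_inter_preimage_eq_mul S (sets := v) hv
    have h3 : ∀ (U : ι → Set β) (V : ι → Set γ), (∀ i ∈ S, MeasurableSet (U i)) →
        (∀ i ∈ S, MeasurableSet (V i)) →
        P ((⋂ i ∈ S, f i ⁻¹' U i) ∩ ⋂ i ∈ S, g i ⁻¹' V i) =
          P (⋂ i ∈ S, f i ⁻¹' U i) * P (⋂ i ∈ S, g i ⁻¹' V i) := by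
      intro U V hU hV
      have h := hfg.measure_inter_preimage_eq_mul ((S : Set ι).pi U) ((S : Set ι).pi V)
        (MeasurableSet.pi S.countable_toSet hU) (MeasurableSet.pi S.countable_toSet hV)
      have e1 : (fun ω i => f i ω) ⁻¹' (S : Set ι).pi U = ⋂ i ∈ S, f i ⁻¹' U i := by
        ext ω; simp [Set.mem_pi]
      have e2 : (fun ω i => g i ω) ⁻¹' (S : Set ι).pi V = ⋂ i ∈ S, g i ⁻¹' V i := by
        ext ω; simp [Set.mem_pi]
      rwa [e1, e2] at h
    have h4 : (⋂ i ∈ S, s i) = (⋂ i ∈ S, f i ⁻¹' u i) ∩ ⋂ i ∈ S, g i ⁻¹' v i := by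
      rw [iInter₂_congr fun i hi => (huv i hi).symm]
      simp only [iInter_inter_distrib]
    rw [h4, h3 u v hu hv, h1, h2, ← Finset.prod_mul_distrib]
    refine Finset.prod_congr rfl fun i hi => ?_
    rw [← huv i hi]
    exact (hfg.comp (measurable_pi_apply i) (measurable_pi_apply i)).measure_inter_preimage_eq_mul
      _ _ (hu i hi) (hv i hi) |>.symm

theorem ProbabilityTheory.iIndepFun.indepFun_of_dependsOn {ι β γ γ' : Type*} [MeasurableSpace β] [Nonempty β]
    [MeasurableSpace γ] [MeasurableSpace γ'] {W : ι → Ω → β} (hW : iIndepFun W P)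
    (hWm : ∀ i, Measurable (W i)) {S T : Finset ι} (hST : Disjoint S T)
    {F : (ι → β) → γ} {G : (ι → β) → γ'} (hF : Measurable F) (hG : Measurable G)
    (hFS : DependsOn F S) (hGT : DependsOn G T) :
    IndepFun (fun ω => F fun i => W i ω) (fun ω => G fun i => W i ω) P := by
  classical
  let x₀ : β := Classical.arbitrary β
  -- Filling the coordinates outside `R` with an arbitrary point makes `F` and `G` functions of
  -- finite blocks.
  let ext : (R : Finset ι) → (R → β) → ι → β := fun R w i =>
    if hi : i ∈ R then w ⟨i, hi⟩ else x₀
  have hext : ∀ R, Measurable (ext R) := by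
    intro R
    refine measurable_pi_lambda _ fun i => ?_
    by_cases hi : i ∈ R
    · simpa [ext, hi] using measurable_pi_apply (⟨i, hi⟩ : R)
    · simp [ext, hi]
  have h := (hW.indepFun_finset S T hST hWm).comp (hF.comp (hext S)) (hG.comp (hext T))
  have e1 : (F ∘ ext S) ∘ (fun ω (i : S) => W i ω) = fun ω => F fun i => W i ω := by
    funext ω
    refine hFS fun i hi => ?_
    have hi' : i ∈ S := hi
    simp [ext, hi']
  have e2 : (G ∘ ext T) ∘ (fun ω (i : T) => W i ω) = fun ω => G fun i => W i ω := by
    funext ω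
    refine hGT fun i hi => ?_
    have hi' : i ∈ T := hi
    simp [ext, hi']
  rwa [e1, e2] at h

/-- The strong law of large numbers for a function of finitely many entries of the rows of an
array of independent and identically distributed variables. -/
theorem ProbabilityTheory.iIndepFun.strong_law_rows [IsProbabilityMeasure P] {β : Type*} [MeasurableSpace β] [Nonempty β]
    {W : ℕ × ℕ → Ω → β} (hW : iIndepFun W P) (hWm : ∀ k, Measurable (W k)) {μ : Measure β}
    (hlaw : ∀ k, P.map (W k) = μ) {F : (ℕ → β) → ℝ} (hF : Measurable F) {n : ℕ}
    (hFn : DependsOn F (Finset.range n)) (hi : Integrable (fun ω => F fun j => W (0, j) ω) P) :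
    ∀ᵐ ω ∂P, Tendsto (fun N : ℕ => (N : ℝ)⁻¹ * ∑ i ∈ Finset.range N, F fun j => W (i, j) ω) atTop
      (𝓝 (∫ ω, F (fun j => W (0, j) ω) ∂P)) := by
  have hmap : ∀ i, P.map (fun ω j => W (i, j) ω) = Measure.infinitePi fun _ : ℕ => μ := by
    intro i
    have h1 : iIndepFun (fun j => W (i, j)) P := hW.precomp (Prod.mk_right_injective i)
    rw [h1.map_fun_eq_infinitePi_map fun j => hWm (i, j)]
    simp_rw [hlaw]
  have h := strong_law_ae_real (fun i ω => F fun j => W (i, j) ω) hi ?_ ?_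
  · filter_upwards [h] with ω hω
    simpa only [div_eq_inv_mul] using hω
  · intro i i' hii'
    -- The strong law asks only for pairwise independence, and two rows read disjoint finite blocks.
    refine hW.indepFun_of_dependsOn hWm (S := {i} ×ˢ Finset.range n)
      (T := {i'} ×ˢ Finset.range n) ?_ (F := fun w => F fun j => w (i, j))
      (G := fun w => F fun j => w (i', j)) (by fun_prop) (by fun_prop) ?_ ?_
    · exact Finset.disjoint_product.2 (Or.inl (by simpa using hii'))
    · exact fun w w' hw => hFn fun j hj => hw (i, j) (by simpa using hj)
    · exact fun w w' hw => hFn fun j hj => hw (i', j) (by simpa using hj)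
  · intro i
    have hrow : ∀ i, Measurable fun ω j => W (i, j) ω := fun i =>
      measurable_pi_lambda _ fun j => hWm (i, j)
    have hid : IdentDistrib (fun ω j => W (i, j) ω) (fun ω j => W (0, j) ω) P P :=
      ⟨(hrow i).aemeasurable, (hrow 0).aemeasurable, by rw [hmap, hmap]⟩
    exact hid.comp hF

end Independence

/-! ### Dependence on finitely many coordinates, and measurability. -/

section Congruence

variable {X : Type*}

theorem stickRemainder_congr {b b' : ℕ → ℝ} {T : ℕ} (h : ∀ j < T, b j = b' j) :
    stickRemainder b T = stickRemainder b' T :=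
  Finset.prod_congr rfl fun j hj => by rw [h j (Finset.mem_range.1 hj)]

theorem stickSum_congr {b b' : ℕ → ℝ} {x x' : ℕ → X} {T : ℕ} (f : X → ℝ)
    (h : ∀ j < T, b j = b' j) (hx : ∀ j < T, x (j + 1) = x' (j + 1)) :
    stickSum b x T f = stickSum b' x' T f := by
  refine Finset.sum_congr rfl fun j hj => ?_
  have hj' := Finset.mem_range.1 hj
  have := stickRemainder_congr fun k (hk : k < j) => h k (hk.trans hj')
  rw [stickRemainder, stickRemainder] at this
  rw [h j hj', hx j hj', this]

theorem dependsOn_truncatedIntegral (f : X → ℝ) (T : ℕ) :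
    DependsOn (fun w : ℕ → ℝ × X => truncatedIntegral (fun j => (w j).1) (fun j => (w j).2) T f)
      (Finset.range (T + 1)) := by
  intro w w' hw
  have hw' : ∀ j ≤ T, w j = w' j := fun j hj => hw j (by simpa [Nat.lt_succ_iff] using hj)
  simp only [truncatedIntegral_eq]
  rw [hw' 0 (Nat.zero_le T), stickRemainder_congr fun j hj => by rw [hw' j hj.le],
    stickSum_congr (x' := fun j => (w' j).2) f (fun j hj => by rw [hw' j hj.le]) fun j hj => by rw [hw' (j + 1) hj]]

end Congruence

section Measurability

variable {X : Type*} [MeasurableSpace X]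

theorem measurable_stickRemainder (T : ℕ) :
    Measurable fun w : ℕ → ℝ × X => stickRemainder (fun j => (w j).1) T := by
  unfold stickRemainder
  fun_prop

theorem measurable_stickSum {f : X → ℝ} (hf : Measurable f) (σ : ℕ → ℕ) (T : ℕ) :
    Measurable fun w : ℕ → ℝ × X => stickSum (fun j => (w j).1) (fun j => (w (σ j)).2) T f := by
  unfold stickSum
  fun_prop

theorem measurable_truncatedIntegral {f : X → ℝ} (hf : Measurable f) (T : ℕ) :
    Measurable fun w : ℕ → ℝ × X =>
      truncatedIntegral (fun j => (w j).1) (fun j => (w j).2) T f := by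
  unfold truncatedIntegral
  fun_prop

end Measurability

/-! ### Expansion along the breaks and the truncation bias. -/

section Expectation

variable {Ω X : Type*} [MeasurableSpace Ω] [MeasurableSpace X] {P : Measure Ω}
  [IsProbabilityMeasure P] {β : Measure ℝ} {q : Measure X} {b : ℕ → Ω → ℝ} {x : ℕ → Ω → X}

theorem integral_stickRemainder (hbm : ∀ j, Measurable (b j)) (hxm : ∀ j, Measurable (x j))
    (hind : iIndepFun (fun j ω => (b j ω, x (j + 1) ω)) P)
    (hlaw : ∀ j, P.map (b j) = β) (T : ℕ) :
    ∫ ω, stickRemainder (fun j => b j ω) T ∂P = (∫ t, (1 - t) ∂β) ^ T := by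
  have hX : Nonempty X := (nonempty_of_isProbabilityMeasure P).map (x 0)
  induction T with
  | zero => simp [stickRemainder]
  | succ T ih =>
    simp_rw [stickRemainder_succ]
    have h1 := hind.indepFun_of_dependsOn (fun j => (hbm j).prodMk (hxm (j + 1)))
      (S := Finset.range T) (T := {T}) (by simp)
      (F := fun w => stickRemainder (fun j => (w j).1) T) (G := fun w => 1 - (w T).1)
      (measurable_stickRemainder T) (by fun_prop)
      (fun w w' hw => stickRemainder_congr fun j hj => by rw [hw j (by simpa using hj)])
      (fun w w' hw => by simp only; rw [hw T (by simp)])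
    have hrm : Measurable fun ω => stickRemainder (fun j => b j ω) T := by
      unfold stickRemainder
      fun_prop
    rw [h1.integral_fun_mul_eq_mul_integral hrm.aestronglyMeasurable
      (by fun_prop : Measurable fun ω => 1 - b T ω).aestronglyMeasurable, ih, pow_succ,
      ← hlaw T, integral_map (hbm T).aemeasurable (by fun_prop)]

variable [IsProbabilityMeasure β] [IsProbabilityMeasure q] {K : ℝ} {ν : Measure ℝ} [IsProbabilityMeasure ν] {h : X → ℝ}

/-- A solution in law of `M = b h(x) + (1 - b) M` can be expanded along `T` breaks. -/
theorem integral_polynomial_stickSum_add (hbm : ∀ j, Measurable (b j))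
    (hxm : ∀ j, Measurable (x j)) (hb : ∀ j ω, b j ω ∈ Icc (0 : ℝ) 1)
    (hind : iIndepFun (fun j ω => (b j ω, x (j + 1) ω)) P)
    (hlaw : ∀ j, P.map (fun ω => (b j ω, x (j + 1) ω)) = β.prod q)
    (hβ : ∀ᵐ b ∂β, b ∈ Icc (0 : ℝ) 1) (hν : ∀ᵐ m ∂ν, m ∈ Icc 0 K)
    (hm : Measurable h) (hK : ∀ y, h y ∈ Icc 0 K)
    (hfix : ∀ p : Polynomial ℝ, ∫ m, p.eval m ∂ν =
      ∫ w, p.eval (w.1.1 * h w.1.2 + (1 - w.1.1) * w.2) ∂((β.prod q).prod ν))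
    (p : Polynomial ℝ) (T : ℕ) :
    ∫ ω, ∫ m, p.eval (stickSum (fun j => b j ω) (fun j => x j ω) T h +
      stickRemainder (fun j => b j ω) T * m) ∂ν ∂P = ∫ m, p.eval m ∂ν := by
  have hX : Nonempty X := nonempty_of_isProbabilityMeasure q
  -- `Φ (A, R)` is the mean of `p (A + R M)`. The equation for the polynomial `p (A + R X)` shows
  -- that one more break leaves it unchanged on average (`hstep`).
  let Φ : ℝ × ℝ → ℝ := fun z => ∫ m, p.eval (z.1 + z.2 * m) ∂ν
  have hΦ : StronglyMeasurable Φ := by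
    refine StronglyMeasurable.integral_prod_right
      (f := fun (z : ℝ × ℝ) m => p.eval (z.1 + z.2 * m)) ?_
    exact (p.continuous.measurable.comp (by fun_prop)).stronglyMeasurable
  let G : (ℝ × ℝ) × (ℝ × X) → ℝ := fun y =>
    Φ (y.1.1 + y.1.2 * (y.2.1 * h y.2.2), y.1.2 * (1 - y.2.1))
  have hG : StronglyMeasurable G := hΦ.comp_measurable (by fun_prop)
  have hstep : ∀ z : ℝ × ℝ, ∫ y, G (z, y) ∂(β.prod q) = Φ z := by
    rintro ⟨A, R⟩
    have h1 := hfix (p.comp (Polynomial.C A + Polynomial.C R * Polynomial.X))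
    simp only [Polynomial.eval_comp, Polynomial.eval_add, Polynomial.eval_mul,
      Polynomial.eval_C, Polynomial.eval_X] at h1
    have hint : Integrable (fun w : (ℝ × X) × ℝ =>
        p.eval (A + R * (w.1.1 * h w.1.2 + (1 - w.1.1) * w.2))) ((β.prod q).prod ν) := by
      obtain ⟨C, hC⟩ := (p.comp (Polynomial.C A + Polynomial.C R * Polynomial.X)).exists_bound_Icc K
      refine Integrable.of_bound (p.continuous.measurable.comp
        (by fun_prop)).aestronglyMeasurable C ?_
      have h2 : ∀ᵐ w ∂((β.prod q).prod ν), w.1.1 ∈ Icc (0 : ℝ) 1 :=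
        (Measure.quasiMeasurePreserving_fst.comp Measure.quasiMeasurePreserving_fst).ae hβ
      have h3 : ∀ᵐ w ∂((β.prod q).prod ν), w.2 ∈ Icc 0 K :=
        Measure.quasiMeasurePreserving_snd.ae hν
      filter_upwards [h2, h3] with w hw1 hw2
      simpa using hC _ (convexCombination_mem_Icc hw1 (hK _) hw2)
    rw [integral_prod _ hint] at h1
    simp only [Φ, G]
    rw [h1]
    refine integral_congr_ae (ae_of_all _ fun y => ?_)
    refine integral_congr_ae (ae_of_all _ fun m => ?_)
    simp only
    congr 1
    ring
  let A : ℕ → Ω → ℝ := fun T ω => stickSum (fun j => b j ω) (fun j => x j ω) T h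
  let R : ℕ → Ω → ℝ := fun T ω => stickRemainder (fun j => b j ω) T
  change ∫ ω, Φ (A T ω, R T ω) ∂P = _
  induction T with
  | zero => simp [Φ, A, R, stickSum, stickRemainder]
  | succ T ih =>
    have hAR : Measurable fun ω => (A T ω, R T ω) := by
      simp only [A, R, stickSum, stickRemainder]
      fun_prop
    have hbx : Measurable fun ω => (b T ω, x (T + 1) ω) := (hbm T).prodMk (hxm (T + 1))
    have hindep : IndepFun (fun ω => (A T ω, R T ω)) (fun ω => (b T ω, x (T + 1) ω)) P :=
      hind.indepFun_of_dependsOn (fun j => (hbm j).prodMk (hxm (j + 1)))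
        (S := Finset.range T) (T := {T}) (by simp)
        -- The pair of index `j` holds the atom `j + 1`; the shift `j - 1` undoes this, so the first
        -- `T` pairs suffice.
        (F := fun w => (stickSum (fun j => (w j).1) (fun j => (w (j - 1)).2) T h,
          stickRemainder (fun j => (w j).1) T)) (G := fun w => w T)
        ((measurable_stickSum hm _ T).prodMk (measurable_stickRemainder T)) (by fun_prop)
        (fun w w' hw => by
          have hw' : ∀ j < T, w j = w' j := fun j hj => hw j (by simpa using hj)
          simp only
          rw [stickRemainder_congr fun j hj => by rw [hw' j hj],
            stickSum_congr (x' := fun j => (w' (j - 1)).2) h (fun j hj => by rw [hw' j hj])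
              fun j hj => by rw [Nat.add_sub_cancel, hw' j hj]])
        (fun w w' hw => hw T (by simp))
    have hjoint := (indepFun_iff_map_prod_eq_prod_map_map hAR.aemeasurable hbx.aemeasurable).1
      hindep
    rw [hlaw T] at hjoint
    have hsucc : ∀ ω, Φ (A (T + 1) ω, R (T + 1) ω) =
        G ((A T ω, R T ω), (b T ω, x (T + 1) ω)) := by
      intro ω
      simp only [G, A, R, stickSum_succ, stickRemainder_succ]
    have hpm : Measurable fun ω => ((A T ω, R T ω), (b T ω, x (T + 1) ω)) := hAR.prodMk hbx
    have hprob : IsProbabilityMeasure (P.map fun ω => (A T ω, R T ω)) :=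
      Measure.isProbabilityMeasure_map hAR.aemeasurable
    have hGi : Integrable G ((P.map fun ω => (A T ω, R T ω)).prod (β.prod q)) := by
      rw [← hjoint, integrable_map_measure hG.aestronglyMeasurable hpm.aemeasurable]
      obtain ⟨C, hC⟩ := p.exists_bound_Icc K
      refine Integrable.of_bound (hG.comp_measurable hpm).aestronglyMeasurable C
        (ae_of_all _ fun ω => ?_)
      simp only [Function.comp_apply]
      rw [← hsucc]
      refine (norm_integral_le_of_norm_le_const (hν.mono fun m hm => hC _ ?_)).trans_eq
        (by rw [probReal_univ, mul_one])
      exact stickSum_add_mem_Icc_zero (x := fun j => x j ω) (fun j => hb j ω) hK hm (T + 1)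
    rw [← ih]
    simp_rw [hsucc]
    rw [← integral_map (f := G) hpm.aemeasurable hG.aestronglyMeasurable, hjoint,
      integral_prod _ hGi]
    simp_rw [hstep]
    exact integral_map hAR.aemeasurable hΦ.aestronglyMeasurable

/-- The truncated integral and the expanded solution share the stick sum and differ only on the
remaining stick, where `h (x 0)` faces `m`, both in `[0, K]`. -/
theorem abs_integral_polynomial_truncatedIntegral_sub_le (hbm : ∀ j, Measurable (b j))
    (hxm : ∀ j, Measurable (x j)) (hb : ∀ j ω, b j ω ∈ Icc (0 : ℝ) 1)
    (hind : iIndepFun (fun j ω => (b j ω, x (j + 1) ω)) P)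
    (hlaw : ∀ j, P.map (fun ω => (b j ω, x (j + 1) ω)) = β.prod q)
    (hβ : ∀ᵐ b ∂β, b ∈ Icc (0 : ℝ) 1) (hν : ∀ᵐ m ∂ν, m ∈ Icc 0 K)
    (hm : Measurable h) (hK : ∀ y, h y ∈ Icc 0 K)
    (hfix : ∀ p : Polynomial ℝ, ∫ m, p.eval m ∂ν =
      ∫ w, p.eval (w.1.1 * h w.1.2 + (1 - w.1.1) * w.2) ∂((β.prod q).prod ν))
    (p : Polynomial ℝ) {L : ℝ} (hL0 : 0 ≤ L)
    (hL : ∀ s ∈ Icc 0 K, ∀ t ∈ Icc 0 K, |p.eval s - p.eval t| ≤ L * |s - t|) (T : ℕ) :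
    |∫ ω, p.eval (truncatedIntegral (fun j => b j ω) (fun j => x j ω) T h) ∂P -
      ∫ m, p.eval m ∂ν| ≤ L * K * ∫ ω, stickRemainder (fun j => b j ω) T ∂P := by
  obtain ⟨C, hC⟩ := p.exists_bound_Icc K
  let A : Ω → ℝ := fun ω => stickSum (fun j => b j ω) (fun j => x j ω) T h
  let R : Ω → ℝ := fun ω => stickRemainder (fun j => b j ω) T
  let Y : Ω → ℝ := fun ω => truncatedIntegral (fun j => b j ω) (fun j => x j ω) T h
  have hAm : Measurable A := by simp only [A, stickSum]; fun_prop
  have hRm : Measurable R := by simp only [R, stickRemainder]; fun_prop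
  have hYm : Measurable Y := by simp only [Y, truncatedIntegral]; fun_prop
  have hYK : ∀ ω, Y ω ∈ Icc 0 K := fun ω => truncatedIntegral_mem_Icc (fun j => hb j ω) hK T
  have hAK : ∀ ω, ∀ m ∈ Icc 0 K, A ω + R ω * m ∈ Icc 0 K := fun ω m hm =>
    stickSum_add_mem_Icc_zero (fun j => hb j ω) hK hm T
  have hR0 : ∀ ω, 0 ≤ R ω := fun ω => stickRemainder_nonneg (fun j => hb j ω) T
  have hRi : Integrable R P := Integrable.of_mem_Icc 0 1 hRm.aemeasurable
    (ae_of_all _ fun ω => ⟨hR0 ω, stickRemainder_le_one (fun j => hb j ω) T⟩)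
  have hi1 : Integrable (fun ω => p.eval (Y ω)) P :=
    Integrable.of_bound (p.continuous.measurable.comp hYm).aestronglyMeasurable C
      (ae_of_all _ fun ω => hC _ (hYK ω))
  have hinner : ∀ ω, Integrable (fun m => p.eval (A ω + R ω * m)) ν := fun ω =>
    Integrable.of_bound (p.continuous.measurable.comp (by fun_prop)).aestronglyMeasurable C
      (hν.mono fun m hm => hC _ (hAK ω m hm))
  have hi2 : Integrable (fun ω => ∫ m, p.eval (A ω + R ω * m) ∂ν) P := by
    refine Integrable.of_bound (StronglyMeasurable.integral_prod_right
      (f := fun ω m => p.eval (A ω + R ω * m))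
      (p.continuous.measurable.comp (by fun_prop)).stronglyMeasurable).aestronglyMeasurable C
      (ae_of_all _ fun ω => ?_)
    exact (norm_integral_le_of_norm_le_const (hν.mono fun m hm => hC _ (hAK ω m hm))).trans_eq
      (by rw [probReal_univ, mul_one])
  rw [← integral_polynomial_stickSum_add hbm hxm hb hind hlaw hβ hν hm hK hfix p T]
  change |∫ ω, p.eval (Y ω) ∂P - ∫ ω, ∫ m, p.eval (A ω + R ω * m) ∂ν ∂P| ≤ L * K * ∫ ω, R ω ∂P
  rw [← integral_sub hi1 hi2, ← integral_const_mul, ← Real.norm_eq_abs]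
  refine norm_integral_le_of_norm_le (hRi.const_mul _) (ae_of_all _ fun ω => ?_)
  have h1 : p.eval (Y ω) - ∫ m, p.eval (A ω + R ω * m) ∂ν =
      ∫ m, (p.eval (Y ω) - p.eval (A ω + R ω * m)) ∂ν := by
    rw [integral_sub (integrable_const _) (hinner ω), integral_const, probReal_univ, one_smul]
  rw [h1]
  refine (norm_integral_le_of_norm_le_const (C := L * K * R ω) (hν.mono fun m hm => ?_)).trans_eq
    (by rw [probReal_univ, mul_one])
  refine (hL _ (hYK ω) _ (hAK ω m hm)).trans ?_
  rw [mul_assoc]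
  refine mul_le_mul_of_nonneg_left ?_ hL0
  have h2 : Y ω - (A ω + R ω * m) = R ω * (h (x 0 ω) - m) := by
    simp only [Y, A, R, truncatedIntegral_eq]
    ring
  rw [h2, abs_mul, abs_of_nonneg (hR0 ω), mul_comm]
  refine mul_le_mul_of_nonneg_right ?_ (hR0 ω)
  have h3 := hK (x 0 ω)
  exact abs_le.2 ⟨by linarith [h3.1, hm.2], by linarith [h3.2, hm.1]⟩

end Expectation

/-! ### Application to the Dirichlet process and the sampling scheme. -/

theorem ae_mem_Icc_betaMeasure (α β : ℝ) : ∀ᵐ b ∂betaMeasure α β, b ∈ Icc (0 : ℝ) 1 := by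
  rw [betaMeasure, ae_withDensity_iff (by unfold betaPDF; fun_prop)]
  refine ae_of_all _ fun b hb => ⟨?_, ?_⟩
  · by_contra h
    exact hb (betaPDF_eq_zero_of_nonpos (not_le.1 h).le)
  · by_contra h
    exact hb (betaPDF_eq_zero_of_one_le (not_le.1 h).le)

theorem integral_one_sub_betaMeasure {η : ℝ} (hη : 0 < η) :
    ∫ b, (1 - b) ∂betaMeasure 1 η = η / (η + 1) := by
  have h := integral_pow_mul_one_sub_pow_betaMeasure hη 0 1
  simp only [pow_zero, pow_one, one_mul, Nat.factorial_zero, Nat.cast_one, mul_one, zero_add,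
    risingFactorial, ascPochhammer_succ_eval, ascPochhammer_zero, Polynomial.eval_one,
    Nat.cast_zero, add_zero] at h
  rw [h]
  field_simp

theorem isProbabilityMeasure_predictiveDist {X : Type*} [MeasurableSpace X] {α : ℝ} (hα : 0 < α)
    (p₀ : Measure X) [IsProbabilityMeasure p₀] {n : ℕ} (data : Fin n → X) :
    IsProbabilityMeasure (predictiveDist α p₀ data) := by
  refine ⟨?_⟩
  have hpos : 0 < α + n := by positivity
  rcases Nat.eq_zero_or_pos n with rfl | hn
  -- For an empty sample the empirical part is the zero measure with weight `0`, so only `p₀` is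
  -- left.
  · simp [predictiveDist, hα.ne']
  · have hn' : (n : ℝ≥0∞) ≠ 0 := by simpa using hn.ne'
    have h1 : empiricalDist data univ = 1 := by
      simp [empiricalDist, ENNReal.inv_mul_cancel hn' (ENNReal.natCast_ne_top n)]
    rw [predictiveDist, Measure.add_apply, Measure.smul_apply, Measure.smul_apply, h1,
      measure_univ, smul_eq_mul, smul_eq_mul, mul_one, mul_one,
      ← ENNReal.ofReal_add (by positivity) (by positivity), ← add_div, div_self hpos.ne',
      ENNReal.ofReal_one]

section DirichletProcess

variable {X : Type*} [MeasurableSpace X] {η : ℝ} {q : Measure X} {Q : Measure (ProbabilityMeasure X)}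

/-- Under a Dirichlet process the law of the mean of `h` solves `M = b h(x) + (1 - b) M`. -/
theorem IsDirichletProcess.integral_polynomial [IsProbabilityMeasure q] (hη : 0 < η)
    (hQ : IsDirichletProcess η q Q) {K : ℝ} {h : X → ℝ} (hm : Measurable h)
    (hK : ∀ x, h x ∈ Icc 0 K) (p : Polynomial ℝ) :
    ∫ m, p.eval m ∂(Q.map fun p : ProbabilityMeasure X => ∫ x, h x ∂(p : Measure X)) =
      ∫ w, p.eval (w.1.1 * h w.1.2 + (1 - w.1.1) * w.2) ∂(((betaMeasure 1 η).prod q).prod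
        (Q.map fun p : ProbabilityMeasure X => ∫ x, h x ∂(p : Measure X))) := by
  have hQp := hQ.isProbabilityMeasure hη
  have hβp := isProbabilityMeasureBeta one_pos hη
  have hMm := measurable_integral_probabilityMeasure hm fun x => (hK x).1
  have hνp : IsProbabilityMeasure
      (Q.map fun p : ProbabilityMeasure X => ∫ x, h x ∂(p : Measure X)) :=
    Measure.isProbabilityMeasure_map hMm.aemeasurable
  refine integral_polynomial_eq_of_moments (ae_mem_Icc_betaMeasure 1 η) ?_ hm hK (fun r => ?_) p
  · refine (ae_map_iff hMm.aemeasurable measurableSet_Icc).2 ?_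
    exact ae_of_all _ fun p => integral_mem_Icc hm hK _
  · have hmap : ∀ k : ℕ,
        ∫ m, m ^ k ∂(Q.map fun p : ProbabilityMeasure X => ∫ x, h x ∂(p : Measure X)) =
          ∫ p : ProbabilityMeasure X, (∫ x, h x ∂(p : Measure X)) ^ k ∂Q := fun k =>
      integral_map hMm.aemeasurable (by fun_prop : Measurable fun m : ℝ => m ^ k).aestronglyMeasurable
    simp_rw [hmap]
    exact hQ.integral_pow hη hm hK r

end DirichletProcess

section Sample

variable {Ω X : Type*} [MeasurableSpace Ω] [MeasurableSpace X] {P : Measure Ω} {η : ℝ}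
  {q : Measure X} {B : ℕ → ℕ → Ω → ℝ} {Z : ℕ → ℕ → Ω → X}

/-- Measurable versions with breaks clamped to `[0, 1]` differ from the draws on one null set, so
that the pathwise bounds may be used for every `ω`. -/
theorem IsStickBreakingSample.exists_measurable (hS : IsStickBreakingSample P η q B Z) :
    ∃ (B' : ℕ → ℕ → Ω → ℝ) (Z' : ℕ → ℕ → Ω → X), IsStickBreakingSample P η q B' Z' ∧
      (∀ i j, Measurable (B' i j)) ∧ (∀ i j, Measurable (Z' i j)) ∧
      (∀ i j ω, B' i j ω ∈ Icc (0 : ℝ) 1) ∧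
      ∀ᵐ ω ∂P, ∀ i j, B' i j ω = B i j ω ∧ Z' i j ω = Z i j ω := by
  let B' : ℕ → ℕ → Ω → ℝ := fun i j ω => max 0 (min 1 ((hS.law_break i j).aemeasurable.mk _ ω))
  let Z' : ℕ → ℕ → Ω → X := fun i j => (hS.law_atom i j).aemeasurable.mk _
  have hB' : ∀ i j, B' i j =ᵐ[P] B i j := by
    intro i j
    have h1 : ∀ᵐ ω ∂P, B i j ω ∈ Icc (0 : ℝ) 1 := by
      have := ae_mem_Icc_betaMeasure 1 η
      rw [← (hS.law_break i j).map_eq] at this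
      exact ae_of_ae_map (hS.law_break i j).aemeasurable this
    filter_upwards [h1, (hS.law_break i j).aemeasurable.ae_eq_mk] with ω h2 h3
    simp only [B', ← h3, min_eq_right h2.2, max_eq_right h2.1]
  have hZ' : ∀ i j, Z' i j =ᵐ[P] Z i j := fun i j => (hS.law_atom i j).aemeasurable.ae_eq_mk.symm
  have hBm : ∀ i j, Measurable (B' i j) := fun i j =>
    measurable_const.max (measurable_const.min (hS.law_break i j).aemeasurable.measurable_mk)
  have hZm : ∀ i j, Measurable (Z' i j) := fun i j =>
    (hS.law_atom i j).aemeasurable.measurable_mk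
  have hBa : (fun ω (k : ℕ × ℕ) => B k.1 k.2 ω) =ᵐ[P] fun ω (k : ℕ × ℕ) => B' k.1 k.2 ω := by
    filter_upwards [ae_all_iff.2 fun k : ℕ × ℕ => hB' k.1 k.2] with ω hω
    exact funext fun k => (hω k).symm
  have hZa : (fun ω (k : ℕ × ℕ) => Z k.1 k.2 ω) =ᵐ[P] fun ω (k : ℕ × ℕ) => Z' k.1 k.2 ω := by
    filter_upwards [ae_all_iff.2 fun k : ℕ × ℕ => hZ' k.1 k.2] with ω hω
    exact funext fun k => (hω k).symm
  refine ⟨B', Z', ⟨fun i j => (hS.law_break i j).congr (hB' i j),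
    fun i j => (hS.law_atom i j).congr (hZ' i j),
    hS.indep_break.congr fun k => (hB' k.1 k.2).symm,
    hS.indep_atom.congr fun k => (hZ' k.1 k.2).symm,
    hS.indep_break_atom.congr hBa hZa⟩, hBm, hZm,
    fun i j ω => ⟨le_max_left _ _, max_le zero_le_one (min_le_left _ _)⟩, ?_⟩
  filter_upwards [hBa, hZa] with ω h1 h2
  exact fun i j => ⟨(congrFun h1 (i, j)).symm, (congrFun h2 (i, j)).symm⟩

/-- Two pairings are used: the identity for the law of large numbers, and `j ↦ j + 1`, which joins
each break to its own atom, for the expansion. -/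
theorem IsStickBreakingSample.iIndepFun_prodMk (hS : IsStickBreakingSample P η q B Z)
    (hBm : ∀ i j, Measurable (B i j)) (hZm : ∀ i j, Measurable (Z i j)) {σ : ℕ → ℕ}
    (hσ : Function.Injective σ) :
    iIndepFun (fun (k : ℕ × ℕ) ω => (B k.1 k.2 ω, Z k.1 (σ k.2) ω)) P := by
  have hinj : Function.Injective fun k : ℕ × ℕ => (k.1, σ k.2) := fun k k' h => by
    simp only [Prod.mk.injEq] at h
    exact Prod.ext h.1 (hσ h.2)
  exact hS.indep_break.prodMk_of_indepFun (hS.indep_atom.precomp hinj)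
    (fun k => hBm k.1 k.2) (fun k => hZm k.1 (σ k.2))
    (hS.indep_break_atom.comp measurable_id
      (by fun_prop : Measurable fun (z : ℕ × ℕ → X) (k : ℕ × ℕ) => z (k.1, σ k.2)))

variable [IsProbabilityMeasure P]

theorem IsStickBreakingSample.map_prodMk (hS : IsStickBreakingSample P η q B Z) (i j j' : ℕ) :
    P.map (fun ω => (B i j ω, Z i j' ω)) = (betaMeasure 1 η).prod q := by
  have h : IndepFun (B i j) (Z i j') P :=
    hS.indep_break_atom.comp (measurable_pi_apply (i, j)) (measurable_pi_apply (i, j'))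
  rw [(indepFun_iff_map_prod_eq_prod_map_map (hS.law_break i j).aemeasurable
    (hS.law_atom i j').aemeasurable).1 h, (hS.law_break i j).map_eq, (hS.law_atom i j').map_eq]

theorem IsStickBreakingSample.integral_stickRemainder (hS : IsStickBreakingSample P η q B Z)
    (hBm : ∀ i j, Measurable (B i j)) (hZm : ∀ i j, Measurable (Z i j)) (hη : 0 < η) (T : ℕ) :
    ∫ ω, stickRemainder (fun j => B 0 j ω) T ∂P = (η / (η + 1)) ^ T := by
  rw [← integral_one_sub_betaMeasure hη]
  exact _root_.integral_stickRemainder (x := Z 0) (hBm 0) (hZm 0)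
    ((hS.iIndepFun_prodMk hBm hZm (add_left_injective 1)).precomp (Prod.mk_right_injective 0))
    (fun j => (hS.law_break 0 j).map_eq) T

/-- The strong law of large numbers for the rows of the stick-breaking sample. -/
theorem IsStickBreakingSample.strong_law (hS : IsStickBreakingSample P η q B Z)
    (hBm : ∀ i j, Measurable (B i j)) (hZm : ∀ i j, Measurable (Z i j))
    {F : (ℕ → ℝ × X) → ℝ} (hF : Measurable F) {n : ℕ} (hFn : DependsOn F (Finset.range n))
    (hi : Integrable (fun ω => F fun j => (B 0 j ω, Z 0 j ω)) P) :
    ∀ᵐ ω ∂P, Tendsto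
      (fun N : ℕ => (N : ℝ)⁻¹ * ∑ i ∈ Finset.range N, F fun j => (B i j ω, Z i j ω)) atTop
      (𝓝 (∫ ω, F (fun j => (B 0 j ω, Z 0 j ω)) ∂P)) := by
  have hX : Nonempty X := (nonempty_of_isProbabilityMeasure P).map (Z 0 0)
  exact (hS.iIndepFun_prodMk hBm hZm Function.injective_id).strong_law_rows
    (fun k => (hBm k.1 k.2).prodMk (hZm k.1 k.2)) (fun k => hS.map_prodMk k.1 k.2 k.2) hF hFn hi

/-- The bias of the truncated stick-breaking representation of a Dirichlet process. -/
theorem IsStickBreakingSample.abs_integral_polynomial_sub_criterion_le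
    [IsProbabilityMeasure q] (hS : IsStickBreakingSample P η q B Z)
    (hBm : ∀ i j, Measurable (B i j)) (hZm : ∀ i j, Measurable (Z i j))
    (hb : ∀ i j ω, B i j ω ∈ Icc (0 : ℝ) 1) (hη : 0 < η)
    {Q : Measure (ProbabilityMeasure X)} (hQ : IsDirichletProcess η q Q)
    {E : Type*} {h : E → X → ℝ} {θ : E} {K : ℝ} (hm : Measurable (h θ))
    (hK : ∀ x, h θ x ∈ Icc 0 K) (p : Polynomial ℝ) {L : ℝ} (hL0 : 0 ≤ L)
    (hL : ∀ s ∈ Icc 0 K, ∀ t ∈ Icc 0 K, |p.eval s - p.eval t| ≤ L * |s - t|) (T : ℕ) :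
    |∫ ω, p.eval (truncatedIntegral (fun j => B 0 j ω) (fun j => Z 0 j ω) T (h θ)) ∂P -
      criterion (fun t => p.eval t) h Q θ| ≤ L * K * (η / (η + 1)) ^ T := by
  have hQp := hQ.isProbabilityMeasure hη
  have hβp := isProbabilityMeasureBeta one_pos hη
  have hMm := measurable_integral_probabilityMeasure hm fun x => (hK x).1
  have hνp : IsProbabilityMeasure
      (Q.map fun p : ProbabilityMeasure X => ∫ x, h θ x ∂(p : Measure X)) :=
    Measure.isProbabilityMeasure_map hMm.aemeasurable
  have hcrit : criterion (fun t => p.eval t) h Q θ =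
      ∫ m, p.eval m ∂(Q.map fun p : ProbabilityMeasure X => ∫ x, h θ x ∂(p : Measure X)) :=
    (integral_map hMm.aemeasurable p.continuous.measurable.aestronglyMeasurable).symm
  rw [hcrit, ← hS.integral_stickRemainder hBm hZm hη T]
  refine abs_integral_polynomial_truncatedIntegral_sub_le (β := betaMeasure 1 η) (q := q)
    (hBm 0) (hZm 0) (hb 0)
    ((hS.iIndepFun_prodMk hBm hZm (add_left_injective 1)).precomp (Prod.mk_right_injective 0))
    (fun j => hS.map_prodMk 0 j (j + 1)) (ae_mem_Icc_betaMeasure 1 η) ?_ hm hK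
    (hQ.integral_polynomial hη hm hK) p hL0 hL T
  refine (ae_map_iff hMm.aemeasurable measurableSet_Icc).2 ?_
  exact ae_of_all _ fun p => integral_mem_Icc hm hK _

end Sample

/-! ### Averages, and replacing `φ` by a polynomial. -/

theorem abs_mean_sub_mean_le {u v w : ℕ → ℝ} (N : ℕ) (h : ∀ i, |u i - v i| ≤ w i) :
    |(N : ℝ)⁻¹ * ∑ i ∈ Finset.range N, u i - (N : ℝ)⁻¹ * ∑ i ∈ Finset.range N, v i| ≤
      (N : ℝ)⁻¹ * ∑ i ∈ Finset.range N, w i := by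
  rw [← mul_sub, ← Finset.sum_sub_distrib, abs_mul, abs_of_nonneg (by positivity)]
  exact mul_le_mul_of_nonneg_left ((Finset.abs_sum_le_sum_abs _ _).trans
    (Finset.sum_le_sum fun i _ => h i)) (by positivity)

theorem abs_mean_sub_mean_le_const {u v : ℕ → ℝ} {ε : ℝ} (hε : 0 ≤ ε) (N : ℕ)
    (h : ∀ i, |u i - v i| ≤ ε) :
    |(N : ℝ)⁻¹ * ∑ i ∈ Finset.range N, u i - (N : ℝ)⁻¹ * ∑ i ∈ Finset.range N, v i| ≤ ε := by
  refine (abs_mean_sub_mean_le N h).trans ?_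
  rw [Finset.sum_const, Finset.card_range, nsmul_eq_mul, ← mul_assoc]
  exact mul_le_of_le_one_left hε inv_mul_le_one

theorem Polynomial.exists_lipschitz_Icc (p : Polynomial ℝ) (K : ℝ) :
    ∃ L, 0 ≤ L ∧ ∀ s ∈ Icc 0 K, ∀ t ∈ Icc 0 K, |p.eval s - p.eval t| ≤ L * |s - t| := by
  obtain ⟨C, hC⟩ := p.derivative.exists_bound_Icc K
  refine ⟨max C 0, le_max_right _ _, fun s hs t ht => ?_⟩
  refine (convex_Icc 0 K).norm_image_sub_le_of_norm_deriv_le (f := fun t => p.eval t)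
    (fun y _ => p.differentiableAt) (fun y hy => ?_) ht hs
  rw [Polynomial.deriv]
  exact (hC y hy).trans (le_max_left _ _)

theorem abs_criterion_sub_le {X E : Type*} [MeasurableSpace X]
    {Q : Measure (ProbabilityMeasure X)} [IsProbabilityMeasure Q] {h : E → X → ℝ} {K : ℝ} {φ ψ : ℝ → ℝ}
    (hφ : ContinuousOn φ (Icc 0 K)) (hψ : Continuous ψ) {ε : ℝ}
    (hε : ∀ s ∈ Icc 0 K, |ψ s - φ s| ≤ ε) {θ : E} (hm : Measurable (h θ))
    (hK : ∀ x, h θ x ∈ Icc 0 K) : |criterion ψ h Q θ - criterion φ h Q θ| ≤ ε := by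
  have hMm := measurable_integral_probabilityMeasure hm fun x => (hK x).1
  have hMK : ∀ p : ProbabilityMeasure X, risk h (p : Measure X) θ ∈ Icc 0 K := fun p =>
    integral_mem_Icc hm hK _
  have hK0 : 0 ≤ K := by
    obtain ⟨p⟩ := nonempty_of_isProbabilityMeasure Q
    exact (hMK p).1.trans (hMK p).2
  -- `φ` is controlled only on `[0, K]`; its constant extension is continuous, hence measurable, and
  -- gives the same criterion.
  have hext : criterion φ h Q θ = criterion (IccExtend hK0 (domRestrict (Icc 0 K) φ)) h Q θ := by
    refine integral_congr_ae (ae_of_all _ fun p => ?_)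
    simp only
    rw [IccExtend_of_mem _ _ (hMK p), domRestrict_apply]
  have hcont : Continuous (IccExtend hK0 (domRestrict (Icc 0 K) φ)) :=
    (continuousOn_iff_continuous_domRestrict.1 hφ).Icc_extend'
  have hint : ∀ g : ℝ → ℝ, Continuous g →
      Integrable (fun p : ProbabilityMeasure X => g (risk h (p : Measure X) θ)) Q := by
    intro g hg
    obtain ⟨C, hC⟩ := isCompact_Icc.exists_bound_of_continuousOn (s := Icc 0 K) hg.continuousOn
    exact Integrable.of_bound (hg.measurable.comp hMm).aestronglyMeasurable C
      (ae_of_all _ fun p => hC _ (hMK p))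
  rw [hext, criterion, criterion, ← integral_sub (hint _ hψ) (hint _ hcont), ← Real.norm_eq_abs]
  refine (norm_integral_le_of_norm_le_const (C := ε) (ae_of_all _ fun p => ?_)).trans_eq
    (by rw [probReal_univ, mul_one])
  rw [IccExtend_of_mem _ _ (hMK p), domRestrict_apply]
  exact hε _ (hMK p)

/-! ### The uniform law of large numbers. -/

section Uniform

variable {Ω X E : Type*} [MeasurableSpace Ω] [MeasurableSpace X] [PseudoMetricSpace E]
  {P : Measure Ω} [IsProbabilityMeasure P] {η : ℝ} {q : Measure X} [IsProbabilityMeasure q]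
  {B : ℕ → ℕ → Ω → ℝ} {Z : ℕ → ℕ → Ω → X} {Q : Measure (ProbabilityMeasure X)}
  {Θ : Set E} {h : E → X → ℝ} {K : ℝ} {c : X → ℝ≥0}

/-- The stick-breaking Monte Carlo criterion with a Lipschitz polynomial is uniformly close to
the exact one. -/
theorem IsStickBreakingSample.ae_abs_polynomial_sub_criterion_le
    (hS : IsStickBreakingSample P η q B Z)
    (hBm : ∀ i j, Measurable (B i j)) (hZm : ∀ i j, Measurable (Z i j))
    (hb : ∀ i j ω, B i j ω ∈ Icc (0 : ℝ) 1) (hη : 0 < η) (hQ : IsDirichletProcess η q Q)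
    (hΘ : TotallyBounded Θ) (hm : ∀ θ ∈ Θ, Measurable (h θ))
    (hK : ∀ θ ∈ Θ, ∀ x, h θ x ∈ Icc 0 K) (hcm : Measurable c)
    (hlip : ∀ x, LipschitzOnWith (c x) (fun θ => h θ x) Θ)
    (hC : ∀ T ≥ 1, lipschitzMean P (B 0) (Z 0) c T < ∞) (p : Polynomial ℝ) {ε : ℝ} (hε : 0 < ε) :
    ∀ᵐ ω ∂P, ∃ n₀ : ℕ, ∀ T ≥ n₀, ∀ N ≥ n₀, ∀ θ ∈ Θ,
      |approxCriterion (fun t => p.eval t) h (fun i j => B i j ω) (fun i j => Z i j ω) θ T N -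
        criterion (fun t => p.eval t) h Q θ| ≤ 7 * ε := by
  obtain ⟨L, hL0, hL⟩ := p.exists_lipschitz_Icc K
  obtain ⟨M, hM⟩ := p.exists_bound_Icc K
  have hρ0 : 0 ≤ η / (η + 1) := by positivity
  have hρ1 : η / (η + 1) < 1 := (div_lt_one (by positivity)).2 (by linarith)
  -- One choice of `S` makes both the bias at `S` and the expected cost of passing from `T ≥ S` to
  -- `S` smaller than `ε`.
  obtain ⟨S, hS1, hSε⟩ : ∃ S ≥ 1, L * K * (η / (η + 1)) ^ S < ε := by
    have h1 : Tendsto (fun S => L * K * (η / (η + 1)) ^ S) atTop (𝓝 0) := by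
      simpa using (tendsto_pow_atTop_nhds_zero_of_lt_one hρ0 hρ1).const_mul (L * K)
    obtain ⟨S, h2, h3⟩ := ((h1.eventually (gt_mem_nhds hε)).and (eventually_ge_atTop 1)).exists
    exact ⟨S, h3, h2⟩
  let FR : (ℕ → ℝ × X) → ℝ := fun w => stickRemainder (fun j => (w j).1) S
  let FC : (ℕ → ℝ × X) → ℝ := fun w =>
    truncatedIntegral (fun j => (w j).1) (fun j => (w j).2) S fun y => (c y : ℝ)
  let FX : E → (ℕ → ℝ × X) → ℝ := fun θ w =>
    truncatedIntegral (fun j => (w j).1) (fun j => (w j).2) S (h θ)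
  let W : ℕ → Ω → ℕ → ℝ × X := fun i ω j => (B i j ω, Z i j ω)
  have hWm : Measurable (W 0) := measurable_pi_lambda _ fun j => (hBm 0 j).prodMk (hZm 0 j)
  have hFRm : Measurable FR := measurable_stickRemainder S
  have hFCm : Measurable FC := measurable_truncatedIntegral (by fun_prop) S
  have hFXm : ∀ θ ∈ Θ, Measurable (FX θ) := fun θ hθ => measurable_truncatedIntegral (hm θ hθ) S
  have hFXK : ∀ θ ∈ Θ, ∀ i ω, FX θ (W i ω) ∈ Icc 0 K := fun θ hθ i ω =>
    truncatedIntegral_mem_Icc (fun j => hb i j ω) (hK θ hθ) S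
  have hR := hS.strong_law hBm hZm hFRm (n := S)
    (fun w w' hw => stickRemainder_congr fun j hj => by rw [hw j (by simpa using hj)])
    (Integrable.of_mem_Icc 0 1 (hFRm.comp hWm).aemeasurable
      (ae_of_all _ fun ω => ⟨stickRemainder_nonneg (fun j => hb 0 j ω) S,
        stickRemainder_le_one (fun j => hb 0 j ω) S⟩))
  have hFC0 : ∀ i ω, 0 ≤ FC (W i ω) := fun i ω =>
    truncatedIntegral_nonneg (fun j => hb i j ω) (fun y => (c y).2) S
  have hFCi : Integrable (fun ω => FC (W 0 ω)) P := by
    refine ⟨(hFCm.comp hWm).aestronglyMeasurable, ?_⟩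
    rw [hasFiniteIntegral_iff_ofReal (ae_of_all _ (hFC0 0))]
    exact hC S hS1
  have hCl := hS.strong_law hBm hZm hFCm (dependsOn_truncatedIntegral _ S) hFCi
  have hX : ∀ θ ∈ Θ, ∀ᵐ ω ∂P, Tendsto
      (fun N : ℕ => (N : ℝ)⁻¹ * ∑ i ∈ Finset.range N, p.eval (FX θ (W i ω))) atTop
      (𝓝 (∫ ω, p.eval (FX θ (W 0 ω)) ∂P)) := by
    intro θ hθ
    refine hS.strong_law hBm hZm (F := fun w => p.eval (FX θ w))
      (p.continuous.measurable.comp (hFXm θ hθ)) (n := S + 1)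
      (fun w w' hw => congrArg (fun t => p.eval t) (dependsOn_truncatedIntegral (h θ) S hw)) ?_
    exact Integrable.of_bound (p.continuous.measurable.comp
      ((hFXm θ hθ).comp hWm)).aestronglyMeasurable M (ae_of_all _ fun ω => hM _ (hFXK θ hθ 0 ω))
  set EC : ℝ := ∫ ω, FC (W 0 ω) ∂P
  have hEC0 : 0 ≤ EC := integral_nonneg (hFC0 0)
  -- The mesh of the net is set by the expected Lipschitz constant at truncation `S`; the `+ 1` in
  -- the witness covers `L * EC = 0`.
  obtain ⟨δ, hδ, hδε⟩ : ∃ δ > 0, L * δ * EC < ε := by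
    refine ⟨ε / (L * EC + 1), by positivity, ?_⟩
    have h1 : 0 < L * EC + 1 := by positivity
    rw [show L * (ε / (L * EC + 1)) * EC = ε * ((L * EC) / (L * EC + 1)) by ring]
    exact mul_lt_of_lt_one_right hε ((div_lt_one h1).2 (lt_add_one _))
  obtain ⟨t, htΘ, htf, ht⟩ := Metric.finite_approx_of_totallyBounded hΘ δ hδ
  have hXt : ∀ᵐ ω ∂P, ∀ θ ∈ t, Tendsto
      (fun N : ℕ => (N : ℝ)⁻¹ * ∑ i ∈ Finset.range N, p.eval (FX θ (W i ω))) atTop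
      (𝓝 (∫ ω, p.eval (FX θ (W 0 ω)) ∂P)) :=
    (ae_ball_iff htf.countable).2 fun θ hθ => hX θ (htΘ hθ)
  have hbias : ∀ θ ∈ Θ, |∫ ω, p.eval (FX θ (W 0 ω)) ∂P - criterion (fun t => p.eval t) h Q θ| ≤
      ε := fun θ hθ =>
    (hS.abs_integral_polynomial_sub_criterion_le hBm hZm hb hη hQ (hm θ hθ) (hK θ hθ) p hL0 hL
      S).trans hSε.le
  have hpair : ∀ θ ∈ Θ, ∀ θ' ∈ Θ, dist θ θ' ≤ δ → ∀ i ω,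
      |p.eval (FX θ (W i ω)) - p.eval (FX θ' (W i ω))| ≤ L * δ * FC (W i ω) := by
    intro θ hθ θ' hθ' hd i ω
    refine (hL _ (hFXK θ hθ i ω) _ (hFXK θ' hθ' i ω)).trans ?_
    rw [mul_assoc]
    refine mul_le_mul_of_nonneg_left ?_ hL0
    rw [mul_comm]
    refine (abs_truncatedIntegral_sub_le (fun j => hb i j ω) (fun y => ?_) S).trans_eq
      (truncatedIntegral_mul_const _ _ S _ δ)
    rw [← Real.dist_eq]
    exact ((hlip y).dist_le_mul θ hθ θ' hθ').trans
      (mul_le_mul_of_nonneg_left hd (c y).2)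
  have hmean : ∀ θ ∈ Θ, ∀ θ' ∈ Θ, dist θ θ' ≤ δ →
      |∫ ω, p.eval (FX θ (W 0 ω)) ∂P - ∫ ω, p.eval (FX θ' (W 0 ω)) ∂P| ≤ ε := by
    intro θ hθ θ' hθ' hd
    have hi : ∀ θ ∈ Θ, Integrable (fun ω => p.eval (FX θ (W 0 ω))) P := fun θ hθ =>
      Integrable.of_bound (p.continuous.measurable.comp
        ((hFXm θ hθ).comp hWm)).aestronglyMeasurable M
        (ae_of_all _ fun ω => hM _ (hFXK θ hθ 0 ω))
    rw [← integral_sub (hi θ hθ) (hi θ' hθ'), ← Real.norm_eq_abs]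
    refine (norm_integral_le_of_norm_le (hFCi.const_mul (L * δ))
      (ae_of_all _ fun ω => hpair θ hθ θ' hθ' hd 0 ω)).trans ?_
    rw [integral_const_mul]
    exact hδε.le
  have hER : ∫ ω, FR (W 0 ω) ∂P = (η / (η + 1)) ^ S := hS.integral_stickRemainder hBm hZm hη S
  filter_upwards [hR, hCl, hXt] with ω hω1 hω2 hω3
  have e1 : ∀ᶠ N : ℕ in atTop,
      L * K * ((N : ℝ)⁻¹ * ∑ i ∈ Finset.range N, FR (W i ω)) < ε :=
    (hω1.const_mul (L * K)).eventually (gt_mem_nhds (hER ▸ hSε))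
  have e2 : ∀ᶠ N : ℕ in atTop,
      L * δ * ((N : ℝ)⁻¹ * ∑ i ∈ Finset.range N, FC (W i ω)) < ε :=
    (hω2.const_mul (L * δ)).eventually (gt_mem_nhds hδε)
  have e3 : ∀ᶠ N : ℕ in atTop, ∀ θ ∈ t,
      |(N : ℝ)⁻¹ * ∑ i ∈ Finset.range N, p.eval (FX θ (W i ω)) -
        ∫ ω, p.eval (FX θ (W 0 ω)) ∂P| < ε := by
    rw [eventually_all_finite htf]
    intro θ hθ
    have h1 := Metric.tendsto_atTop.1 (hω3 θ hθ) ε hε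
    obtain ⟨n, hn⟩ := h1
    filter_upwards [eventually_ge_atTop n] with N hN
    simpa [Real.dist_eq] using hn N hN
  obtain ⟨n₁, hn₁⟩ := eventually_atTop.1 (e1.and (e2.and e3))
  refine ⟨max S n₁, fun T hT N hN θ hθ => ?_⟩
  obtain ⟨f1, f2, f3⟩ := hn₁ N ((le_max_right _ _).trans hN)
  obtain ⟨θ', hθ't, hθθ'⟩ := mem_iUnion₂.1 (ht hθ)
  have hθ' := htΘ hθ't
  have hd : dist θ θ' ≤ δ := (Metric.mem_ball.1 hθθ').le
  have g1 : |approxCriterion (fun t => p.eval t) h (fun i j => B i j ω) (fun i j => Z i j ω) θ T N -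
      (N : ℝ)⁻¹ * ∑ i ∈ Finset.range N, p.eval (FX θ (W i ω))| ≤
      L * K * ((N : ℝ)⁻¹ * ∑ i ∈ Finset.range N, FR (W i ω)) := by
    rw [mul_left_comm, Finset.mul_sum (Finset.range N) (fun i => FR (W i ω))]
    refine abs_mean_sub_mean_le N fun i => ?_
    refine (hL _ (truncatedIntegral_mem_Icc (fun j => hb i j ω) (hK θ hθ) T) _
      (hFXK θ hθ i ω)).trans ?_
    rw [mul_assoc]
    refine mul_le_mul_of_nonneg_left ?_ hL0
    rw [mul_comm K]
    exact abs_sub_truncatedIntegral_le (fun j => hb i j ω) (hK θ hθ) ((le_max_left _ _).trans hT)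
  have g2 : |(N : ℝ)⁻¹ * ∑ i ∈ Finset.range N, p.eval (FX θ (W i ω)) -
      (N : ℝ)⁻¹ * ∑ i ∈ Finset.range N, p.eval (FX θ' (W i ω))| ≤
      L * δ * ((N : ℝ)⁻¹ * ∑ i ∈ Finset.range N, FC (W i ω)) := by
    rw [mul_left_comm, Finset.mul_sum (Finset.range N) (fun i => FC (W i ω))]
    exact abs_mean_sub_mean_le N fun i => hpair θ hθ θ' hθ' hd i ω
  have g3 := (f3 θ' hθ't).le
  have g4 := hmean θ hθ θ' hθ' hd
  have g5 := hbias θ hθ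
  rw [abs_le] at g1 g2 g3 g4 g5 ⊢
  -- The chain is: `T` to `S`, `θ` to `θ'`, average to mean at `θ'`, back to `θ`, then the bias.
  -- Each link costs at most `ε`, so `7 * ε` leaves room.
  constructor <;> linarith [g1.1, g1.2, g2.1, g2.2, g3.1, g3.2, g4.1, g4.2, g5.1, g5.2]

theorem IsStickBreakingSample.ae_abs_sub_criterion_le (hS : IsStickBreakingSample P η q B Z)
    (hη : 0 < η) (hQ : IsDirichletProcess η q Q)
    (hΘ : TotallyBounded Θ) (hm : ∀ θ ∈ Θ, Measurable (h θ))
    (hK : ∀ θ ∈ Θ, ∀ x, h θ x ∈ Icc 0 K) (hcm : Measurable c)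
    (hlip : ∀ x, LipschitzOnWith (c x) (fun θ => h θ x) Θ)
    (hC : ∀ T ≥ 1, lipschitzMean P (B 0) (Z 0) c T < ∞) {φ : ℝ → ℝ}
    (hφ : ContinuousOn φ (Icc 0 K)) {ε : ℝ} (hε : 0 < ε) :
    ∀ᵐ ω ∂P, ∃ n₀ : ℕ, ∀ T ≥ n₀, ∀ N ≥ n₀, ∀ θ ∈ Θ,
      |approxCriterion φ h (fun i j => B i j ω) (fun i j => Z i j ω) θ T N -
        criterion φ h Q θ| ≤ ε := by
  have hQp := hQ.isProbabilityMeasure hη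
  obtain ⟨B', Z', hS', hBm, hZm, hb, hae⟩ := hS.exists_measurable
  have hC' : ∀ T ≥ 1, lipschitzMean P (B' 0) (Z' 0) c T < ∞ := by
    intro T hT
    refine lt_of_eq_of_lt (lintegral_congr_ae ?_) (hC T hT)
    filter_upwards [hae] with ω hω
    simp only [(hω 0 _).1, (hω 0 _).2]
  -- Seven parts for the polynomial criterion, and one for replacing `φ` in each of the two
  -- criteria.
  have hε9 : 0 < ε / 9 := by positivity
  obtain ⟨p, hp⟩ := exists_polynomial_near_of_continuousOn 0 K φ hφ (ε / 9) hε9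
  filter_upwards [hae, hS'.ae_abs_polynomial_sub_criterion_le hBm hZm hb hη hQ hΘ hm hK hcm hlip
    hC' p hε9] with ω hω ⟨n₀, hn₀⟩
  refine ⟨n₀, fun T hT N hN θ hθ => ?_⟩
  have h1 := hn₀ T hT N hN θ hθ
  have h2 := abs_criterion_sub_le (Q := Q) hφ p.continuous (fun s hs => (hp s hs).le) (hm θ hθ)
    (hK θ hθ)
  have h3 : |approxCriterion (fun t => p.eval t) h (fun i j => B' i j ω) (fun i j => Z' i j ω) θ T N -
      approxCriterion φ h (fun i j => B' i j ω) (fun i j => Z' i j ω) θ T N| ≤ ε / 9 :=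
    abs_mean_sub_mean_le_const hε9.le N fun i =>
      (hp _ (truncatedIntegral_mem_Icc (fun j => hb i j ω) (hK θ hθ) T)).le
  simp only [(hω _ _).1, (hω _ _).2] at h1 h3
  rw [abs_le] at h1 h2 h3 ⊢
  constructor <;> linarith [h1.1, h1.2, h2.1, h2.2, h3.1, h3.2]

end Uniform

/-! ### Joint limits and convergence of minimizers. -/

theorem tendsto_prod_atTop_nhds_of_forall {u : ℕ × ℕ → ℝ} {a : ℝ}
    (h : ∀ ε > 0, ∃ n₀ : ℕ, ∀ T ≥ n₀, ∀ N ≥ n₀, |u (T, N) - a| ≤ ε) :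
    Tendsto u atTop (𝓝 a) := by
  rw [Metric.tendsto_atTop]
  intro ε hε
  obtain ⟨n₀, hn₀⟩ := h (ε / 2) (by positivity)
  refine ⟨(n₀, n₀), fun TN hTN => ?_⟩
  rw [Real.dist_eq]
  exact (hn₀ TN.1 hTN.1 TN.2 hTN.2).trans_lt (half_lt_self hε)
theorem mainTheorem7 {d m n : ℕ}
    (Θ : Set (EuclideanSpace ℝ (Fin d))) (Ξ : Set (EuclideanSpace ℝ (Fin m)))
    (K : ℝ) (h : EuclideanSpace ℝ (Fin d) → Ξ → ℝ)
    (h_meas : ∀ θ ∈ Θ, Measurable (h θ))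
    (h_range : ∀ θ ∈ Θ, ∀ ξ, h θ ξ ∈ Icc 0 K)
    (φ : ℝ → ℝ) (φ_cont : ContinuousOn φ (Icc 0 K)) (φ_convex : ConvexOn ℝ (Icc 0 K) φ)
    (φ_mono : StrictMonoOn φ (Icc 0 K)) (φ_nonneg : ∀ t ∈ Icc 0 K, 0 ≤ φ t)
    -- the Dirichlet process posterior
    (α : ℝ) (hα : 0 < α) (p₀ : Measure Ξ) [IsProbabilityMeasure p₀] (data : Fin n → Ξ)
    (Q : Measure (ProbabilityMeasure Ξ)) (hQ : IsDPPosterior α p₀ data Q)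
    -- the Monte Carlo draws
    {Ω : Type*} [MeasurableSpace Ω] (P : Measure Ω) [IsProbabilityMeasure P]
    (B : ℕ → ℕ → Ω → ℝ) (Z : ℕ → ℕ → Ω → Ξ)
    (hBZ : IsStickBreakingSample P (α + n) (predictiveDist α p₀ data) B Z)
    -- boundedness, the Lipschitz condition, and the bound on the constants `C_T`
    (hΘ : Bornology.IsBounded Θ) (c : Ξ → ℝ≥0) (c_meas : Measurable c)
    (h_lip : ∀ ξ, LipschitzOnWith (c ξ) (fun θ => h θ ξ) Θ)
    (hC : (⨆ T ≥ 1, lipschitzMean P (B 0) (Z 0) c T) < ∞) :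
    (∀ᵐ ω ∂P, Tendsto
      (fun TN : ℕ × ℕ => ⨆ θ ∈ Θ, ENNReal.ofReal
        |approxCriterion φ h (fun i j => B i j ω) (fun i j => Z i j ω) θ TN.1 TN.2
          - criterion φ h Q θ|)
      atTop (𝓝 0)) ∧
    ∀ θn, IsMinimizer (criterion φ h Q) Θ θn →
      ∀ᵐ ω ∂P, ∀ θhat : ℕ → ℕ → EuclideanSpace ℝ (Fin d),
        (∀ T ≥ 1, ∀ N ≥ 1, IsMinimizer
          (fun θ => approxCriterion φ h (fun i j => B i j ω) (fun i j => Z i j ω) θ T N) Θ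
          (θhat T N)) →
        Tendsto
          (fun TN : ℕ × ℕ => approxCriterion φ h (fun i j => B i j ω) (fun i j => Z i j ω)
            (θhat TN.1 TN.2) TN.1 TN.2)
          atTop (𝓝 (criterion φ h Q θn)) ∧
        Tendsto (fun TN : ℕ × ℕ => criterion φ h Q (θhat TN.1 TN.2))
          atTop (𝓝 (criterion φ h Q θn)) := by
  have hη : 0 < α + n := by positivity
  have hq := isProbabilityMeasure_predictiveDist hα p₀ data
  have hC' : ∀ T ≥ 1, lipschitzMean P (B 0) (Z 0) c T < ∞ := fun T hT =>
    (le_iSup₂ (f := fun T (_ : T ≥ 1) => lipschitzMean P (B 0) (Z 0) c T) T hT).trans_lt hC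
  -- Countably many tolerances give a single null set, which serves every `ε` and every choice of
  -- minimizers.
  have hmain : ∀ᵐ ω ∂P, ∀ k : ℕ, ∃ n₀ : ℕ, ∀ T ≥ n₀, ∀ N ≥ n₀, ∀ θ ∈ Θ,
      |approxCriterion φ h (fun i j => B i j ω) (fun i j => Z i j ω) θ T N -
        criterion φ h Q θ| ≤ 1 / ((k : ℝ) + 1) :=
    ae_all_iff.2 fun k => hBZ.ae_abs_sub_criterion_le hη hQ
      (hΘ.isCompact_closure.totallyBounded.subset subset_closure) h_meas h_range c_meas
      h_lip hC' φ_cont (by positivity)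
  have hunif : ∀ᵐ ω ∂P, ∀ ε > 0, ∃ n₀ : ℕ, ∀ T ≥ n₀, ∀ N ≥ n₀, ∀ θ ∈ Θ,
      |approxCriterion φ h (fun i j => B i j ω) (fun i j => Z i j ω) θ T N -
        criterion φ h Q θ| ≤ ε := by
    filter_upwards [hmain] with ω hω ε hε
    obtain ⟨k, hk⟩ := exists_nat_one_div_lt hε
    obtain ⟨n₀, hn₀⟩ := hω k
    exact ⟨n₀, fun T hT N hN θ hθ => (hn₀ T hT N hN θ hθ).trans hk.le⟩
  refine ⟨?_, fun θn hθn => ?_⟩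
  · filter_upwards [hunif] with ω hω
    rw [ENNReal.tendsto_nhds_zero]
    intro ε hε
    rcases eq_or_ne ε ⊤ with rfl | hεt
    · exact Eventually.of_forall fun _ => le_top
    obtain ⟨n₀, hn₀⟩ := hω ε.toReal (ENNReal.toReal_pos hε.ne' hεt)
    filter_upwards [eventually_ge_atTop (n₀, n₀)] with TN hTN
    exact iSup₂_le fun θ hθ => (ENNReal.ofReal_le_ofReal
      (hn₀ TN.1 hTN.1 TN.2 hTN.2 θ hθ)).trans_eq (ENNReal.ofReal_toReal hεt)
  · filter_upwards [hunif] with ω hω θhat hθhat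
    constructor
    · refine tendsto_prod_atTop_nhds_of_forall fun ε hε => ?_
      obtain ⟨n₀, hn₀⟩ := hω ε hε
      -- The maximum with `1` is needed because `θhat T N` is a minimizer only for `T, N ≥ 1`. The
      -- upper bound compares with `θn` through the approximate criterion, the lower bound through
      -- the exact one.
      refine ⟨max n₀ 1, fun T hT N hN => ?_⟩
      have hmin := hθhat T ((le_max_right _ _).trans hT) N ((le_max_right _ _).trans hN)
      have h1 := hn₀ T ((le_max_left _ _).trans hT) N ((le_max_left _ _).trans hN)
      have h2 := abs_le.1 (h1 _ hmin.1)
      have h3 := abs_le.1 (h1 _ hθn.1)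
      have h4 := isMinOn_iff.1 hmin.2 _ hθn.1
      have h5 := isMinOn_iff.1 hθn.2 _ hmin.1
      simp only at h4 ⊢
      rw [abs_le]
      constructor <;> linarith [h2.1, h2.2, h3.1, h3.2]
    · refine tendsto_prod_atTop_nhds_of_forall fun ε hε => ?_
      -- The uniform error is paid twice, at `θhat T N` and at `θn`; the lower bound is the
      -- minimality of `θn`.
      obtain ⟨n₀, hn₀⟩ := hω (ε / 2) (by positivity)
      refine ⟨max n₀ 1, fun T hT N hN => ?_⟩
      have hmin := hθhat T ((le_max_right _ _).trans hT) N ((le_max_right _ _).trans hN)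
      have h1 := hn₀ T ((le_max_left _ _).trans hT) N ((le_max_left _ _).trans hN)
      have h2 := abs_le.1 (h1 _ hmin.1)
      have h3 := abs_le.1 (h1 _ hθn.1)
      have h4 := isMinOn_iff.1 hmin.2 _ hθn.1
      have h5 := isMinOn_iff.1 hθn.2 _ hmin.1
      simp only at h4 ⊢
      rw [abs_le]
      constructor <;> linarith [h2.1, h2.2, h3.1, h3.2]
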